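/- Let $k,n\ge 0$ be integers with $n\ge 2k-1$. Let $\mathrm{St}(k,n)=\{A\in \mathrm{Mat}_{k\times n}(\mathbb C): AA^T=\mathrm{Id}_k\}$, and regard $\mathrm{Mat}_{k\times n}(\mathbb C)$ as the chart $\{z_0\ne 0\}$ of $\mathbb P(\mathrm{Mat}_{k\times n}(\mathbb C)\oplus\mathbb C)$, where $z_0$ is the coordinate on the summand $\mathbb C$. Let $\overline{\mathrm{St}(k,n)}$ be the Zariski closure of $\mathrm{St}(k,n)$ in this projective space, and let $$\mathcal Z(k,n)=\{[A:z_0] : AA^T=z_0^2\,\mathrm{Id}_k\}.$$ Then $\overline{\mathrm{St}(k,n)}=\mathcal Z(k,n)$, and this variety is a complete intersection of $\binom{k+1}{2}$ quadrics: its codimension is $\binom{k+1}{2}$, and its homogeneous ideal (the ideal of all polynomials vanishing on it) is generated by the $\binom{k+1}{2}$ quadratic forms given by the entries on and above the diagonal of $AA^T-z_0^2\,\mathrm{Id}_k$. Consequently $$\deg \mathrm{St}(k,n)=\deg\overline{\mathrm{St}(k,n)}=2^{\binom{k+1}{2}}.$$ Here the degree of a variety $X$ is $(\dim X)!$ times the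 leading coefficient of its Hilbert polynomial, a polynomial of degree $\dim X$. The Hilbert polynomial is the polynomial that agrees for all large $t$ with the Hilbert function of $X$. For projective $X$ with homogeneous coordinate ring $\mathbb C[X]$ the Hilbert function is $t\mapsto\dim\mathbb C[X]_t$, and for affine $X$ it is $t\mapsto\dim\mathbb C[X]_{\le t}$, where $\mathbb C[X]_{\le t}$ is the space of functions on $X$ that are restrictions of polynomials of degree at most $t$. -/

import Mathlib

open MvPolynomial Filter
open scoped Matrix Nat LinearAlgebra.Projectivization

noncomputable section

namespace StiefelDegree

/-! ### Affine and projective varieties over `ℂ` -/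

section Varieties

variable {σ : Type}

/-- A polynomial `F` vanishes at the point `p` of projective space: it vanishes at every vector of
the line `p`. For homogeneous `F` one nonzero representative suffices,
see `vanishesAt_mk_iff`. -/
def VanishesAt (F : MvPolynomial σ ℂ) (p : ℙ ℂ (σ → ℂ)) : Prop :=
  ∀ v ∈ p.submodule, eval v F = 0

/-- A homogeneous polynomial vanishes at a point of projective space if and only if it vanishes at
a representative. -/
theorem vanishesAt_mk_iff [Fintype σ] {F : MvPolynomial σ ℂ} {d : ℕ}
    (hF : F.IsHomogeneous d) (v : σ → ℂ) (hv : v ≠ 0) : VanishesAt F (Projectivization.mk ℂ v hv) ↔ eval v F = 0 := by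
  simp only [VanishesAt, Projectivization.submodule_mk]
  constructor
  · intro h
    exact h v (Submodule.mem_span_singleton_self v)
  · intro h w hw
    obtain ⟨a, rfl⟩ := Submodule.mem_span_singleton.1 hw
    rw [show (a • v) = fun i => a * v i from rfl]
    have key : eval (fun i => a * v i) F = a ^ d * eval v F := by
      rw [eval_eq', eval_eq', Finset.mul_sum]
      refine Finset.sum_congr rfl fun m hm => ?_
      have hd : ∑ i, m i = d := by
        rw [← Finsupp.degree_eq_sum]
        exact by_contra fun hne => mem_support_iff.1 hm (hF.coeff_eq_zero hne)
      simp only [mul_pow, Finset.prod_mul_distrib, Finset.prod_pow_eq_pow_sum, hd]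
      ring
    rw [key, h, mul_zero]

/-- A subset of projective space is Zariski closed if it is the common zero locus of a set of
homogeneous polynomials. -/
def IsZariskiClosed (Y : Set (ℙ ℂ (σ → ℂ))) : Prop :=
  ∃ S : Set (MvPolynomial σ ℂ),
    (∀ F ∈ S, ∃ d : ℕ, F.IsHomogeneous d) ∧ Y = {p | ∀ F ∈ S, VanishesAt F p}

/-- The Zariski closure in projective space: the smallest Zariski closed set containing `X`. -/
def zariskiClosure (X : Set (ℙ ℂ (σ → ℂ))) : Set (ℙ ℂ (σ → ℂ)) :=
  ⋂₀ {Y | IsZariskiClosed Y ∧ X ⊆ Y}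

/-- The homogeneous ideal `I_X` of a subset `X` of projective space, that is, the ideal of all
polynomials vanishing on the affine cone over `X`. -/
def projIdeal (X : Set (ℙ ℂ (σ → ℂ))) : Ideal (MvPolynomial σ ℂ) :=
  vanishingIdeal ℂ {v : σ → ℂ | ∃ p ∈ X, v ∈ p.submodule}

/-- The Hilbert function of `X ⊆ ℙ(ℂ^σ)`: the dimension of the degree `t` part of the homogeneous
coordinate ring `ℂ[σ] / I_X`. -/
def projHilbertFunction (X : Set (ℙ ℂ (σ → ℂ))) (t : ℕ) : ℕ :=
  Module.finrank ℂ
    ((homogeneousSubmodule σ ℂ t).map (Ideal.Quotient.mkₐ ℂ (projIdeal X)).toLinearMap)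

/-- The Hilbert function of `X ⊆ ℂ^σ`: the dimension of the space of regular functions on `X` that
are restrictions of polynomials of degree at most `t`. -/
def affineHilbertFunction (X : Set (σ → ℂ)) (t : ℕ) : ℕ :=
  Module.finrank ℂ
    ((restrictTotalDegree σ ℂ t).map
      (Ideal.Quotient.mkₐ ℂ (vanishingIdeal ℂ X)).toLinearMap)

/-- The Hilbert function `HF` eventually agrees with a polynomial `P` (the Hilbert polynomial, whose
degree `m` is the dimension of the variety), and `d` is `m!` times its leading coefficient. -/
def HilbertFunctionHasDegree (HF : ℕ → ℕ) (d : ℕ) : Prop :=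
  ∃ P : Polynomial ℚ, (∀ᶠ t : ℕ in atTop, (HF t : ℚ) = P.eval (t : ℚ)) ∧
    (P.natDegree ! : ℚ) * P.leadingCoeff = d

/-- The projective variety `X` has degree `d`. -/
def ProjHasDegree (X : Set (ℙ ℂ (σ → ℂ))) (d : ℕ) : Prop :=
  HilbertFunctionHasDegree (projHilbertFunction X) d

/-- The affine variety `X` has degree `d`. -/
def AffineHasDegree (X : Set (σ → ℂ)) (d : ℕ) : Prop :=
  HilbertFunctionHasDegree (affineHilbertFunction X) d

/-- `X ⊆ ℙ(ℂ^σ)` has codimension `c`. The dimension of `X` is one less than the Krull dimension of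
its homogeneous coordinate ring, and that of `ℙ(ℂ^σ)` is `card σ - 1`. -/
def ProjHasCodim [Fintype σ] (X : Set (ℙ ℂ (σ → ℂ))) (c : ℕ) : Prop :=
  ringKrullDim (MvPolynomial σ ℂ ⧸ projIdeal X) + (c : WithBot ℕ∞) = Fintype.card σ

/-- The projective variety `X` is a complete intersection of the hypersurfaces `f i = 0`, where
`f i` is homogeneous of degree `d i`: the ideal of `X` is generated by the `f i`, and their number
is the codimension of `X`. -/
structure IsCompleteIntersection [Fintype σ] {ι : Type} [Fintype ι] (X : Set (ℙ ℂ (σ → ℂ)))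
    (f : ι → MvPolynomial σ ℂ) (d : ι → ℕ) : Prop where
  isClosed : IsZariskiClosed X
  isHomogeneous : ∀ i, (f i).IsHomogeneous (d i)
  ideal_eq : projIdeal X = Ideal.span (Set.range f)
  codim_eq : ProjHasCodim X (Fintype.card ι)

end Varieties

/-! ### Stiefel manifolds -/

/-- The complex Stiefel manifold `St(k,n)` of `k × n` matrices with `A Aᵀ = 1`. -/
def stiefel (k n : ℕ) : Set (Matrix (Fin k) (Fin n) ℂ) :=
  {A | A * Aᵀ = 1}

/-- The vector of entries of a matrix. -/
def entries {k n : ℕ} (A : Matrix (Fin k) (Fin n) ℂ) : Fin k × Fin n → ℂ :=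
  fun p => A p.1 p.2

/-- `St(k,n)` as a subset of the affine space with coordinates the matrix entries. -/
def stiefelAffine (k n : ℕ) : Set (Fin k × Fin n → ℂ) :=
  entries '' stiefel k n

/-- Homogeneous coordinates on `ℙ(Mat_{k×n} ⊕ ℂ)`: the entries `some (i, j)` of the matrix and the
additional coordinate `z₀`, which is `none`. -/
abbrev Coord (k n : ℕ) : Type := Option (Fin k × Fin n)

/-- The vector `(A, z₀)` of `Mat_{k×n} ⊕ ℂ`. -/
def pairVec {k n : ℕ} (A : Matrix (Fin k) (Fin n) ℂ) (z₀ : ℂ) : Coord k n → ℂ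
  | none => z₀
  | some p => A p.1 p.2

/-- The matrix component of a vector of `Mat_{k×n} ⊕ ℂ`. -/
def matPart {k n : ℕ} (v : Coord k n → ℂ) : Matrix (Fin k) (Fin n) ℂ :=
  Matrix.of fun i j => v (some (i, j))

theorem pairVec_one_ne_zero {k n : ℕ} (A : Matrix (Fin k) (Fin n) ℂ) : pairVec A 1 ≠ 0 :=
  fun h => one_ne_zero (congrFun h none)

/-- The inclusion of `Mat_{k×n}` in `ℙ(Mat_{k×n} ⊕ ℂ)` as the chart `z₀ ≠ 0`. -/
def affineChart {k n : ℕ} (A : Matrix (Fin k) (Fin n) ℂ) : ℙ ℂ (Coord k n → ℂ) :=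
  Projectivization.mk ℂ (pairVec A 1) (pairVec_one_ne_zero A)

/-- The closure of `St(k,n)` in `ℙ(Mat_{k×n} ⊕ ℂ)`. -/
def stiefelClosure (k n : ℕ) : Set (ℙ ℂ (Coord k n → ℂ)) :=
  zariskiClosure (affineChart '' stiefel k n)

/-- The naive homogenization `Z(k,n)`: the points `[A : z₀]` with `A Aᵀ = z₀² Id`. -/
def naiveHomogenization (k n : ℕ) : Set (ℙ ℂ (Coord k n → ℂ)) :=
  {p | matPart p.rep * (matPart p.rep)ᵀ = (p.rep none) ^ 2 • (1 : Matrix (Fin k) (Fin k) ℂ)}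

/-- The condition defining `Z(k,n)` does not depend on the representative. -/
theorem mk_mem_naiveHomogenization_iff {k n : ℕ} (v : Coord k n → ℂ) (hv : v ≠ 0) :
    Projectivization.mk ℂ v hv ∈ naiveHomogenization k n ↔
      matPart v * (matPart v)ᵀ = (v none) ^ 2 • (1 : Matrix (Fin k) (Fin k) ℂ) := by
  obtain ⟨a, ha⟩ := Projectivization.exists_smul_eq_mk_rep ℂ v hv
  have h0 : ((a : ℂ) ^ 2) ≠ 0 := pow_ne_zero _ a.ne_zero
  have h1 : matPart ((a : ℂ) • v) = (a : ℂ) • matPart v := rfl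
  have h2 : ((a : ℂ) • v) none = (a : ℂ) * v none := rfl
  have ha' : (a : ℂ) • v = (Projectivization.mk ℂ v hv).rep := ha
  simp only [naiveHomogenization, Set.mem_ofPred_eq]
  rw [← ha', h1, h2, Matrix.transpose_smul, Matrix.smul_mul, Matrix.mul_smul, smul_smul, mul_pow,
    ← pow_two, ← smul_smul ((a : ℂ) ^ 2)]
  exact (smul_right_injective _ h0).eq_iff

/-- The positions `i ≤ j` on and above the diagonal of a `k × k` matrix. -/
abbrev UpperIndex (k : ℕ) : Type := {p : Fin k × Fin k // p.1 ≤ p.2}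

/-- The `(i, j)` entry of the symmetric matrix `A Aᵀ - z₀² Id`, as a polynomial. -/
def quadric (k n : ℕ) (p : UpperIndex k) : MvPolynomial (Coord k n) ℂ :=
  (∑ l : Fin n, X (some (p.1.1, l)) * X (some (p.1.2, l)))
    - if p.1.1 = p.1.2 then X none ^ 2 else 0

end StiefelDegree

end

/-!
The quadrics `q_{ij} = ∑_l a_{il} a_{jl} - δ_{ij} z₀²`, `i ≤ j`, have pairwise coprime leading
monomials for a suitable weight. Give `a_{il}` the weight `4 i l + n² - l²` and `z₀` the weight `0`;
then `a_{il} a_{jl}` has weight `2 n² + 2 (i + j)² - 2 (l - (i + j))²`, so the only heaviest monomial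
of `q_{ij}` is `a_{i,i+j} a_{j,i+j}`. The column `i + j` exists because `n ≥ 2 k - 1`.

Every monomial is uniquely a product of powers of the leading monomials and of a standard monomial,
one that is divisible by no leading monomial. Replacing in it each leading monomial by its quadric
defines a linear map `monomialMap (substituted μ q)` of the polynomial ring to itself. It is
triangular for the weight, hence bijective; it preserves degrees, and it turns multiplication by a
leading monomial into multiplication by the quadric. So it carries the ideal of the leading
monomials to the ideal `I` of the quadrics (`monomialMap_mem_span_iff`), and three facts can be read
off from monomials: the quadrics form a regular sequence, `z₀` is a nonzerodivisor modulo `I`, and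
the standard monomials are a basis of the quotient by `I`. The first one together with Krull's
height theorem gives the codimension `m`. The third one gives the Hilbert series
`(1 - X²)^m / (1 - X)^N = (1 + X)^m / (1 - X)^(N - m)`, where `N` is the number of variables, and
hence the degree `2^m`.

The ideal `I` is radical (`isRadical_quadricIdeal`). Let `U` be the left `k × k` block of the matrix
and `D` a diagonal matrix of signs. Where `z₀` and `det (z₀ D + U)` are invertible, a Cayley
transform linearizes the equations: with `T = (1 + z₀⁻¹ D U)⁻¹` and `W = T (z₀⁻¹ D A + (1 | 0))`, the
equation `A Aᵀ = z₀²` becomes `T + Tᵀ = W Wᵀ`, which only prescribes the symmetric part of `T`. So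
this part of the scheme of `I` is open in an affine space and nilpotents vanish on it. The signed sum
of the `det (z₀ D + U)` over all `D` is `2^k z₀^k` (`sum_sign_mul_det`), and `z₀` is a
nonzerodivisor, so nilpotents vanish everywhere.

By the Nullstellensatz `I` is then the ideal of `Z(k,n)`. If `F` vanishes on `St(k,n)`, then `z₀ F`
vanishes on `Z(k,n)`, so `z₀ F ∈ I` and `F ∈ I`; therefore `Z(k,n)` is the closure of `St(k,n)`.
The same argument identifies the affine Hilbert function of `St(k,n)` with the projective one of its
closure by means of dehomogenization.
-/

noncomputable section

namespace StiefelDegree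

/-! ### Polynomials with a leading monomial and triangular endomorphisms -/

section Triangular

variable {σ K : Type*} [Field K]

/-- The exponents that come after `γ`: those of the same total degree and of smaller
`w`-weight. -/
def lowerExponents (w : σ → ℕ) (γ : σ →₀ ℕ) : Set (σ →₀ ℕ) :=
  {δ | δ.degree = γ.degree ∧ Finsupp.weight w δ < Finsupp.weight w γ}

/-- The polynomial `f` has leading monomial `γ` with coefficient `1`, for the weight `w`: all its
other monomials have the same total degree as `γ` and smaller weight. -/
def HasLeadingMonomial (w : σ → ℕ) (f : MvPolynomial σ K) (γ : σ →₀ ℕ) : Prop :=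
  f - monomial γ 1 ∈ restrictSupport K (lowerExponents w γ)

open scoped Pointwise in
theorem mul_mem_restrictSupport {s t u : Set (σ →₀ ℕ)} {f g : MvPolynomial σ K}
    (hf : f ∈ restrictSupport K s) (hg : g ∈ restrictSupport K t)
    (h : ∀ a ∈ s, ∀ b ∈ t, a + b ∈ u) : f * g ∈ restrictSupport K u := by
  refine restrictSupport_mono K (s := s + t) ?_ ?_
  · rintro _ ⟨a, ha, b, hb, rfl⟩
    exact h a ha b hb
  · rw [restrictSupport_add]
    exact Submodule.mul_mem_mul hf hg

theorem hasLeadingMonomial_monomial (w : σ → ℕ) (γ : σ →₀ ℕ) :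
    HasLeadingMonomial w (monomial γ (1 : K)) γ := by
  simp [HasLeadingMonomial]

theorem HasLeadingMonomial.mul {w : σ → ℕ} {f g : MvPolynomial σ K} {γ δ : σ →₀ ℕ}
    (hf : HasLeadingMonomial w f γ) (hg : HasLeadingMonomial w g δ) :
    HasLeadingMonomial w (f * g) (γ + δ) := by
  have key : f * g - monomial (γ + δ) 1 =
      (f - monomial γ 1) * (g - monomial δ 1) + (f - monomial γ 1) * monomial δ 1 +
        monomial γ 1 * (g - monomial δ 1) := by
    rw [show (monomial (γ + δ) (1 : K)) = monomial γ 1 * monomial δ 1 by simp]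
    ring
  have hm : ∀ γ : σ →₀ ℕ, monomial γ (1 : K) ∈ restrictSupport K {γ} := fun γ => by
    simp [monomial_mem_restrictSupport]
  rw [HasLeadingMonomial, key]
  refine add_mem (add_mem ?_ ?_) ?_
  · refine mul_mem_restrictSupport hf hg fun a ha b hb => ?_
    simp only [lowerExponents, Set.mem_ofPred_eq, map_add] at *
    omega
  · refine mul_mem_restrictSupport hf (hm δ) fun a ha b hb => ?_
    obtain rfl : b = δ := hb
    simp only [lowerExponents, Set.mem_ofPred_eq, map_add] at *
    omega
  · refine mul_mem_restrictSupport (hm γ) hg fun a ha b hb => ?_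
    obtain rfl : a = γ := ha
    simp only [lowerExponents, Set.mem_ofPred_eq, map_add] at *
    omega

theorem HasLeadingMonomial.pow {w : σ → ℕ} {f : MvPolynomial σ K} {γ : σ →₀ ℕ}
    (hf : HasLeadingMonomial w f γ) (a : ℕ) : HasLeadingMonomial w (f ^ a) (a • γ) := by
  induction a with
  | zero => simpa using hasLeadingMonomial_monomial (K := K) w 0
  | succ a ih =>
    rw [pow_succ, succ_nsmul]
    exact ih.mul hf

theorem HasLeadingMonomial.prod {ι : Type*} {w : σ → ℕ} (s : Finset ι)
    {f : ι → MvPolynomial σ K} {γ : ι → σ →₀ ℕ} (hf : ∀ i, HasLeadingMonomial w (f i) (γ i)) :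
    HasLeadingMonomial w (∏ i ∈ s, f i) (∑ i ∈ s, γ i) := by
  classical
  induction s using Finset.induction_on with
  | empty => simpa using hasLeadingMonomial_monomial (K := K) w 0
  | insert i s hi ih =>
    rw [Finset.prod_insert hi, Finset.sum_insert hi]
    exact (hf i).mul ih

/-- The linear endomorphism of the polynomial ring that sends the monomial `γ` to `b γ`. -/
def monomialMap (b : (σ →₀ ℕ) → MvPolynomial σ K) :
    MvPolynomial σ K →ₗ[K] MvPolynomial σ K :=
  (basisMonomials σ K).constr K b

@[simp]
theorem monomialMap_monomial (b : (σ →₀ ℕ) → MvPolynomial σ K) (γ : σ →₀ ℕ) :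
    monomialMap b (monomial γ 1) = b γ := by
  rw [monomialMap, show monomial γ (1 : K) = basisMonomials σ K γ by simp,
    Module.Basis.constr_basis]

/-- The exponents with total degree in `A` and weight less than `W`. -/
def boundedExponents (w : σ → ℕ) (A : Set ℕ) (W : ℕ) : Set (σ →₀ ℕ) :=
  {δ | δ.degree ∈ A ∧ Finsupp.weight w δ < W}

theorem exists_mem_boundedExponents (w : σ → ℕ) {A : Set ℕ} {f : MvPolynomial σ K}
    (hf : f ∈ restrictSupport K {δ | δ.degree ∈ A}) :
    ∃ W, f ∈ restrictSupport K (boundedExponents w A W) := by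
  refine ⟨f.support.sup (Finsupp.weight w) + 1, fun δ hδ => ⟨hf hδ, ?_⟩⟩
  exact Nat.lt_succ_of_le (Finset.le_sup (f := Finsupp.weight w) hδ)

/-- A triangular endomorphism differs from the identity by a map that lowers the weight bound. -/
theorem monomialMap_sub_mem {w : σ → ℕ} {b : (σ →₀ ℕ) → MvPolynomial σ K}
    (hb : ∀ γ, HasLeadingMonomial w (b γ) γ) {A : Set ℕ} {W : ℕ} {f : MvPolynomial σ K}
    (hf : f ∈ restrictSupport K (boundedExponents w A (W + 1))) :
    monomialMap b f - f ∈ restrictSupport K (boundedExponents w A W) := by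
  suffices h : restrictSupport K (boundedExponents w A (W + 1)) ≤
      (restrictSupport K (boundedExponents w A W)).comap (monomialMap b - LinearMap.id) from h hf
  rw [restrictSupport_eq_span, Submodule.span_le]
  rintro _ ⟨γ, hγ, rfl⟩
  simp only [Submodule.comap_coe, Set.mem_preimage, LinearMap.sub_apply, monomialMap_monomial,
    LinearMap.id_apply, SetLike.mem_coe]
  refine restrictSupport_mono K ?_ (hb γ)
  rintro δ ⟨h1, h2⟩
  exact ⟨h1 ▸ hγ.1, lt_of_lt_of_le h2 (Nat.le_of_lt_succ hγ.2)⟩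

theorem eq_zero_of_mem_boundedExponents_zero {w : σ → ℕ} {A : Set ℕ} {f : MvPolynomial σ K}
    (hf : f ∈ restrictSupport K (boundedExponents w A 0)) : f = 0 := by
  rw [← support_eq_empty, Finset.eq_empty_iff_forall_notMem]
  exact fun δ hδ => Nat.not_lt_zero _ (hf hδ).2

theorem mem_restrictSupport_degree_univ (f : MvPolynomial σ K) :
    f ∈ restrictSupport K {δ : σ →₀ ℕ | δ.degree ∈ Set.univ} :=
  fun _ _ => Set.mem_univ _

theorem monomialMap_injective {w : σ → ℕ} {b : (σ →₀ ℕ) → MvPolynomial σ K}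
    (hb : ∀ γ, HasLeadingMonomial w (b γ) γ) : Function.Injective (monomialMap b) := by
  rw [injective_iff_map_eq_zero]
  intro f hf
  obtain ⟨W, hW⟩ := exists_mem_boundedExponents w (mem_restrictSupport_degree_univ f)
  induction W with
  | zero => exact eq_zero_of_mem_boundedExponents_zero hW
  | succ W ih =>
    have h := monomialMap_sub_mem hb hW
    rw [hf, zero_sub, Submodule.neg_mem_iff] at h
    exact ih h

theorem exists_monomialMap_eq {w : σ → ℕ} {b : (σ →₀ ℕ) → MvPolynomial σ K}
    (hb : ∀ γ, HasLeadingMonomial w (b γ) γ) {A : Set ℕ} {f : MvPolynomial σ K}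
    (hf : f ∈ restrictSupport K {δ | δ.degree ∈ A}) :
    ∃ g ∈ restrictSupport K {δ : σ →₀ ℕ | δ.degree ∈ A}, monomialMap b g = f := by
  obtain ⟨W, hW⟩ := exists_mem_boundedExponents w hf
  induction W generalizing f with
  | zero => exact ⟨0, zero_mem _, by rw [eq_zero_of_mem_boundedExponents_zero hW, map_zero]⟩
  | succ W ih =>
    have h := monomialMap_sub_mem hb hW
    obtain ⟨g, hg, hgf⟩ := ih (restrictSupport_mono K (fun δ hδ => hδ.1) h) h
    exact ⟨f - g, sub_mem hf hg, by rw [map_sub, hgf]; abel⟩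

theorem monomialMap_surjective {w : σ → ℕ} {b : (σ →₀ ℕ) → MvPolynomial σ K}
    (hb : ∀ γ, HasLeadingMonomial w (b γ) γ) : Function.Surjective (monomialMap b) := fun f =>
  let ⟨g, _, hg⟩ := exists_monomialMap_eq hb (mem_restrictSupport_degree_univ f)
  ⟨g, hg⟩

theorem restrictSupport_degree_le_comap_monomialMap {w : σ → ℕ}
    {b : (σ →₀ ℕ) → MvPolynomial σ K} (hb : ∀ γ, HasLeadingMonomial w (b γ) γ) (A : Set ℕ) :
    restrictSupport K {δ : σ →₀ ℕ | δ.degree ∈ A} ≤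
      (restrictSupport K {δ : σ →₀ ℕ | δ.degree ∈ A}).comap (monomialMap b) := by
  intro f hf
  obtain ⟨W, hW⟩ := exists_mem_boundedExponents w hf
  have hsub : boundedExponents w A W ⊆ boundedExponents w A (W + 1) :=
    fun δ hδ => ⟨hδ.1, Nat.lt_succ_of_lt hδ.2⟩
  have h := monomialMap_sub_mem hb (restrictSupport_mono K hsub hW)
  have h' := add_mem (restrictSupport_mono K (fun δ hδ => hδ.1) h) hf
  rwa [sub_add_cancel] at h'

end Triangular

/-! ### Pairwise coprime monomials -/

section Coprime

variable {σ ι K : Type*}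

/-- The largest `a` such that the `a`-th power of the monomial `m` divides the monomial `γ`,
for `m ≠ 0`. -/
def monomialMultiplicity (m γ : σ →₀ ℕ) : ℕ :=
  open Classical in Nat.findGreatest (fun a => a • m ≤ γ) γ.degree

theorem le_monomialMultiplicity_iff {m : σ →₀ ℕ} (hm : m ≠ 0) (γ : σ →₀ ℕ) (a : ℕ) :
    a ≤ monomialMultiplicity m γ ↔ a • m ≤ γ := by
  have hdeg : 0 < m.degree := by
    rw [Nat.pos_iff_ne_zero, Ne, Finsupp.degree_eq_zero_iff]
    exact hm
  constructor
  · intro h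
    have h0 : monomialMultiplicity m γ • m ≤ γ :=
      Nat.findGreatest_spec (P := fun a => a • m ≤ γ) (Nat.zero_le γ.degree) (by simp)
    exact (nsmul_le_nsmul_left zero_le h).trans h0
  · intro h
    have hle : a ≤ γ.degree := by
      have h1 : (a • m).degree ≤ γ.degree := Finsupp.degree_mono h
      rw [map_nsmul, smul_eq_mul] at h1
      exact (Nat.le_mul_of_pos_right a hdeg).trans h1
    exact Nat.le_findGreatest (P := fun a => a • m ≤ γ) hle h

theorem monomialMultiplicity_add_self {m : σ →₀ ℕ} (hm : m ≠ 0) (γ : σ →₀ ℕ) :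
    monomialMultiplicity m (γ + m) = monomialMultiplicity m γ + 1 := by
  refine eq_of_forall_le_iff fun a => ?_
  rw [le_monomialMultiplicity_iff hm]
  cases a with
  | zero => simp
  | succ a =>
    rw [succ_nsmul, add_le_add_iff_right, add_le_add_iff_right, le_monomialMultiplicity_iff hm]

/-- If the monomials `m` and `δ` are coprime, then `m` divides `γ + δ` only if it divides `γ`. -/
theorem le_add_iff_of_disjoint {m δ : σ →₀ ℕ} (h : Disjoint m.support δ.support) (γ : σ →₀ ℕ) :
    m ≤ γ + δ ↔ m ≤ γ := by
  refine ⟨fun h1 s => ?_, fun h1 => h1.trans le_self_add⟩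
  by_cases hs : s ∈ m.support
  · have hδ : δ s = 0 := Finsupp.notMem_support_iff.1 (Finset.disjoint_left.1 h hs)
    simpa [hδ] using h1 s
  · simp [Finsupp.notMem_support_iff.1 hs]

theorem monomialMultiplicity_add_of_disjoint {m δ : σ →₀ ℕ} (hm : m ≠ 0)
    (h : Disjoint m.support δ.support) (γ : σ →₀ ℕ) :
    monomialMultiplicity m (γ + δ) = monomialMultiplicity m γ := by
  refine eq_of_forall_le_iff fun a => ?_
  rw [le_monomialMultiplicity_iff hm, le_monomialMultiplicity_iff hm, le_add_iff_of_disjoint]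
  exact h.mono_left Finsupp.support_smul

/-- The monomials `μ p` are nontrivial and pairwise coprime. -/
structure IsCoprimeFamily (μ : ι → σ →₀ ℕ) : Prop where
  ne_zero : ∀ p, μ p ≠ 0
  disjoint : ∀ p q, p ≠ q → Disjoint (μ p).support (μ q).support

variable [Fintype ι] {μ : ι → σ →₀ ℕ}

theorem IsCoprimeFamily.sum_le (hμ : IsCoprimeFamily μ) (γ : σ →₀ ℕ) :
    ∑ p, monomialMultiplicity (μ p) γ • μ p ≤ γ := by
  intro s
  rw [Finsupp.finsetSum_apply]
  by_cases h : ∃ p, s ∈ (μ p).support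
  · obtain ⟨p, hp⟩ := h
    rw [Finset.sum_eq_single p]
    · exact (le_monomialMultiplicity_iff (hμ.ne_zero p) γ _).1 le_rfl s
    · intro q _ hq
      have := Finset.disjoint_left.1 (hμ.disjoint p q hq.symm) hp
      simp [Finsupp.notMem_support_iff.1 this]
    · simp
  · push Not at h
    rw [Finset.sum_eq_zero]
    · exact Nat.zero_le _
    · intro p _
      simp [Finsupp.notMem_support_iff.1 (h p)]

/-- What is left of the monomial `γ` when all powers of the `μ p` have been divided out. -/
def reducedPart (μ : ι → σ →₀ ℕ) (γ : σ →₀ ℕ) : σ →₀ ℕ :=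
  γ - ∑ p, monomialMultiplicity (μ p) γ • μ p

omit [Fintype ι] in
theorem IsCoprimeFamily.multiplicity_add [DecidableEq ι] (hμ : IsCoprimeFamily μ) (γ : σ →₀ ℕ)
    (p q : ι) :
    monomialMultiplicity (μ q) (γ + μ p) =
      monomialMultiplicity (μ q) γ + if q = p then 1 else 0 := by
  split_ifs with h
  · subst h
    exact monomialMultiplicity_add_self (hμ.ne_zero q) γ
  · exact monomialMultiplicity_add_of_disjoint (hμ.ne_zero q) (hμ.disjoint q p h) γ

variable [Field K]

/-- The product of the powers of the polynomials `q p` and of the variables that is obtained from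
the monomial `γ` by replacing the factors `μ p` by `q p`. -/
def substituted (μ : ι → σ →₀ ℕ) (q : ι → MvPolynomial σ K) (γ : σ →₀ ℕ) : MvPolynomial σ K :=
  (∏ p, q p ^ monomialMultiplicity (μ p) γ) * monomial (reducedPart μ γ) 1

variable {q : ι → MvPolynomial σ K}

theorem hasLeadingMonomial_substituted (hμ : IsCoprimeFamily μ) {w : σ → ℕ}
    (hq : ∀ p, HasLeadingMonomial w (q p) (μ p)) (γ : σ →₀ ℕ) :
    HasLeadingMonomial w (substituted μ q γ) γ := by
  have h := (HasLeadingMonomial.prod (w := w) Finset.univ fun p =>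
    (hq p).pow (monomialMultiplicity (μ p) γ)).mul
      (hasLeadingMonomial_monomial (K := K) w (reducedPart μ γ))
  rwa [reducedPart, add_tsub_cancel_of_le (hμ.sum_le γ)] at h

theorem substituted_add (hμ : IsCoprimeFamily μ) (γ : σ →₀ ℕ) (p : ι) :
    substituted μ q (γ + μ p) = q p * substituted μ q γ := by
  classical
  have h1 : reducedPart μ (γ + μ p) = reducedPart μ γ := by
    simp only [reducedPart, hμ.multiplicity_add, add_smul, Finset.sum_add_distrib, ite_smul,
      one_smul, zero_smul, Finset.sum_ite_eq', Finset.mem_univ, if_true, add_tsub_add_eq_tsub_right]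
  simp only [substituted, h1, hμ.multiplicity_add, pow_add, Finset.prod_mul_distrib, pow_ite,
    pow_one, pow_zero, Finset.prod_ite_eq', Finset.mem_univ, if_true]
  ring

theorem substituted_add_of_disjoint (hμ : IsCoprimeFamily μ) {δ : σ →₀ ℕ}
    (hδ : ∀ p, Disjoint (μ p).support δ.support) (γ : σ →₀ ℕ) :
    substituted μ q (γ + δ) = monomial δ 1 * substituted μ q γ := by
  have h0 : ∀ p, monomialMultiplicity (μ p) (γ + δ) = monomialMultiplicity (μ p) γ := fun p =>
    monomialMultiplicity_add_of_disjoint (hμ.ne_zero p) (hδ p) γ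
  have h1 : reducedPart μ (γ + δ) = δ + reducedPart μ γ := by
    simp only [reducedPart, h0]
    rw [add_comm γ δ, add_tsub_assoc_of_le (hμ.sum_le γ)]
  simp only [substituted, h0, h1]
  rw [show (monomial (δ + reducedPart μ γ) (1 : K)) = monomial δ 1 * monomial (reducedPart μ γ) 1
    by simp]
  ring

/-- If multiplication by the monomial `δ` becomes multiplication by `f` on the basis `b`, then
`monomialMap b` intertwines the two multiplications. -/
theorem monomialMap_monomial_mul {b : (σ →₀ ℕ) → MvPolynomial σ K} {δ : σ →₀ ℕ}
    {f : MvPolynomial σ K} (h : ∀ γ, b (γ + δ) = f * b γ) (g : MvPolynomial σ K) :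
    monomialMap b (monomial δ 1 * g) = f * monomialMap b g := by
  have : monomialMap b ∘ₗ LinearMap.mulLeft K (monomial δ 1) =
      LinearMap.mulLeft K f ∘ₗ monomialMap b := by
    refine (basisMonomials σ K).ext fun γ => ?_
    simp only [coe_basisMonomials, LinearMap.comp_apply, LinearMap.mulLeft_apply,
      monomialMap_monomial, monomial_mul, one_mul]
    rw [add_comm, h]
  exact LinearMap.congr_fun this g

/-- The exponents of the monomials that are divisible by some `μ p` with `p ∈ T`. -/
def divisibleExponents (μ : ι → σ →₀ ℕ) (T : Set ι) : Set (σ →₀ ℕ) :=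
  {γ | ∃ p ∈ T, μ p ≤ γ}

/-- The image of the monomial ideal of the `μ p` under the triangular map is the ideal of
the `q p`. -/
theorem monomialMap_mem_span_iff (hμ : IsCoprimeFamily μ) {w : σ → ℕ}
    (hq : ∀ p, HasLeadingMonomial w (q p) (μ p)) (T : Set ι) (f : MvPolynomial σ K) :
    monomialMap (substituted μ q) f ∈ Ideal.span (q '' T) ↔
      f ∈ restrictSupport K (divisibleExponents μ T) := by
  have hb := hasLeadingMonomial_substituted hμ hq
  constructor
  · suffices h : ∀ g ∈ Ideal.span (q '' T), ∃ f ∈ restrictSupport K (divisibleExponents μ T),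
        monomialMap (substituted μ q) f = g by
      intro hf
      obtain ⟨f', hf', h'⟩ := h _ hf
      rwa [← monomialMap_injective hb h']
    intro g hg
    induction hg using Submodule.closure_induction with
    | zero => exact ⟨0, zero_mem _, map_zero _⟩
    | add x y hx hy h1 h2 =>
      obtain ⟨f1, h1, rfl⟩ := h1
      obtain ⟨f2, h2, rfl⟩ := h2
      exact ⟨f1 + f2, add_mem h1 h2, map_add _ _ _⟩
    | smul_mem r x hx =>
      obtain ⟨p, hp, rfl⟩ := hx
      obtain ⟨f, rfl⟩ := monomialMap_surjective hb r
      refine ⟨monomial (μ p) 1 * f, ?_, ?_⟩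
      · refine mul_mem_restrictSupport (s := {μ p}) (t := Set.univ) ?_ ?_ ?_
        · simp [monomial_mem_restrictSupport]
        · simp
        · rintro _ rfl γ -
          exact ⟨p, hp, le_self_add⟩
      · rw [monomialMap_monomial_mul fun γ => substituted_add hμ γ p, smul_eq_mul, mul_comm]
  · suffices h : restrictSupport K (divisibleExponents μ T) ≤
        ((Ideal.span (q '' T)).restrictScalars K).comap (monomialMap (substituted μ q)) from
      fun hf => h hf
    rw [restrictSupport_eq_span, Submodule.span_le]
    rintro _ ⟨γ, ⟨p, hp, hle⟩, rfl⟩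
    simp only [Submodule.comap_coe, Set.mem_preimage, monomialMap_monomial, SetLike.mem_coe,
      Submodule.restrictScalars_mem]
    rw [← tsub_add_cancel_of_le hle, substituted_add hμ]
    exact Ideal.mul_mem_right _ _ (Ideal.subset_span ⟨p, hp, rfl⟩)

omit [Fintype ι] in
theorem mem_restrictSupport_of_monomial_mul_mem {μ : ι → σ →₀ ℕ} {T : Set ι} {δ : σ →₀ ℕ}
    (hδ : ∀ p ∈ T, Disjoint (μ p).support δ.support) {f : MvPolynomial σ K}
    (hf : monomial δ 1 * f ∈ restrictSupport K (divisibleExponents μ T)) :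
    f ∈ restrictSupport K (divisibleExponents μ T) := by
  intro γ hγ
  have h : γ + δ ∈ (monomial δ 1 * f).support := by
    rw [mem_support_iff, add_comm, coeff_monomial_mul, one_mul]
    exact mem_support_iff.1 hγ
  obtain ⟨p, hp, hle⟩ := hf h
  exact ⟨p, hp, (le_add_iff_of_disjoint (hδ p hp) γ).1 hle⟩

/-- Each `q p` is a nonzerodivisor modulo the others. -/
theorem mem_span_of_mul_mem_span (hμ : IsCoprimeFamily μ) {w : σ → ℕ}
    (hq : ∀ p, HasLeadingMonomial w (q p) (μ p)) {T : Set ι} {p : ι} (hp : p ∉ T)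
    {f : MvPolynomial σ K} (hf : q p * f ∈ Ideal.span (q '' T)) : f ∈ Ideal.span (q '' T) := by
  obtain ⟨f, rfl⟩ := monomialMap_surjective (hasLeadingMonomial_substituted hμ hq) f
  rw [← monomialMap_monomial_mul fun γ => substituted_add hμ γ p,
    monomialMap_mem_span_iff hμ hq] at hf
  rw [monomialMap_mem_span_iff hμ hq]
  refine mem_restrictSupport_of_monomial_mul_mem (fun p' hp' => hμ.disjoint p' p ?_) hf
  rintro rfl
  exact hp hp'

/-- A variable that divides no `μ p` is a nonzerodivisor modulo the `q p`. -/
theorem mem_span_of_X_mul_mem_span (hμ : IsCoprimeFamily μ) {w : σ → ℕ}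
    (hq : ∀ p, HasLeadingMonomial w (q p) (μ p)) {s : σ} (hs : ∀ p, s ∉ (μ p).support)
    {f : MvPolynomial σ K} (hf : X s * f ∈ Ideal.span (Set.range q)) :
    f ∈ Ideal.span (Set.range q) := by
  have hδ : ∀ p, Disjoint (μ p).support (Finsupp.single s 1).support := fun p => by
    rw [Finsupp.support_single s one_ne_zero, Finset.disjoint_singleton_right]
    exact hs p
  obtain ⟨f, rfl⟩ := monomialMap_surjective (hasLeadingMonomial_substituted hμ hq) f
  rw [← Set.image_univ] at hf ⊢
  rw [X, ← monomialMap_monomial_mul (substituted_add_of_disjoint hμ hδ),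
    monomialMap_mem_span_iff hμ hq] at hf
  rw [monomialMap_mem_span_iff hμ hq]
  exact mem_restrictSupport_of_monomial_mul_mem (fun p _ => hδ p) hf

end Coprime

/-! ### Hilbert functions -/

section HilbertFunction

variable {σ ι K : Type*}

/-- The exponents of total degree `t` of the monomials that are divisible by no `μ p`
with `p ∈ T`. -/
def standardExponents (μ : ι → σ →₀ ℕ) (T : Set ι) (t : ℕ) : Set (σ →₀ ℕ) :=
  {γ | γ.degree = t ∧ γ ∉ divisibleExponents μ T}

theorem homogeneousSubmodule_eq_restrictSupport [Field K] (t : ℕ) :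
    homogeneousSubmodule σ K t = restrictSupport K {γ : σ →₀ ℕ | γ.degree ∈ ({t} : Set ℕ)} := by
  ext f
  simp only [mem_homogeneousSubmodule, IsHomogeneous, IsWeightedHomogeneous,
    mem_restrictSupport_iff, Set.subset_def, Finset.mem_coe, mem_support_iff, Set.mem_ofPred_eq,
    Set.mem_singleton_iff, Finsupp.degree_eq_weight_one]
  rfl

theorem finrank_restrictSupport [Field K] (S : Set (σ →₀ ℕ)) :
    Module.finrank K (restrictSupport K S) = S.ncard :=
  Module.finrank_eq_nat_card_basis (basisRestrictSupport K S)

/-- The standard monomials of degree `t` are mapped to a basis of the degree `t` part of the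
quotient by the ideal of the `q p`. -/
theorem finrank_map_mk_homogeneousSubmodule [Field K] [Fintype ι] {μ : ι → σ →₀ ℕ}
    {q : ι → MvPolynomial σ K} (hμ : IsCoprimeFamily μ) {w : σ → ℕ}
    (hq : ∀ p, HasLeadingMonomial w (q p) (μ p)) (t : ℕ) :
    Module.finrank K ((homogeneousSubmodule σ K t).map
      (Ideal.Quotient.mkₐ K (Ideal.span (Set.range q))).toLinearMap) =
        (standardExponents μ Set.univ t).ncard := by
  have hb := hasLeadingMonomial_substituted hμ hq
  set π := (Ideal.Quotient.mkₐ K (Ideal.span (Set.range q))).toLinearMap with hπ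
  have hker : ∀ f, π (monomialMap (substituted μ q) f) = 0 ↔
      f ∈ restrictSupport K (divisibleExponents μ Set.univ) := fun f => by
    rw [← monomialMap_mem_span_iff hμ hq, Set.image_univ]
    exact Ideal.Quotient.eq_zero_iff_mem
  set S := standardExponents μ Set.univ t
  have hSA : restrictSupport K S ≤ restrictSupport K {γ : σ →₀ ℕ | γ.degree ∈ ({t} : Set ℕ)} :=
    restrictSupport_mono K fun γ hγ => hγ.1
  set F := (π ∘ₗ monomialMap (substituted μ q)).domRestrict (restrictSupport K S) with hF
  have hinj : Function.Injective F := by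
    rw [injective_iff_map_eq_zero]
    rintro ⟨f, hf⟩ h
    have h' := (hker f).1 h
    ext1
    rw [ZeroMemClass.coe_zero, ← support_eq_empty, Finset.eq_empty_iff_forall_notMem]
    exact fun δ hδ => (hf hδ).2 (h' hδ)
  have hrange : LinearMap.range F = (homogeneousSubmodule σ K t).map π := by
    rw [homogeneousSubmodule_eq_restrictSupport]
    apply le_antisymm
    · rintro _ ⟨⟨f, hf⟩, rfl⟩
      exact ⟨_, restrictSupport_degree_le_comap_monomialMap hb {t} (hSA hf), rfl⟩
    · rintro _ ⟨g, hg, rfl⟩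
      obtain ⟨f, hf, rfl⟩ := exists_monomialMap_eq hb hg
      have hsplit : restrictSupport K {γ : σ →₀ ℕ | γ.degree ∈ ({t} : Set ℕ)} ≤
          restrictSupport K S ⊔ restrictSupport K (divisibleExponents μ Set.univ) := by
        rw [restrictSupport_eq_span, Submodule.span_le]
        rintro _ ⟨γ, hγ, rfl⟩
        by_cases h : γ ∈ divisibleExponents μ Set.univ
        · exact Submodule.mem_sup_right ((monomial_mem_restrictSupport K).2 (Or.inl h))
        · exact Submodule.mem_sup_left ((monomial_mem_restrictSupport K).2 (Or.inl ⟨hγ, h⟩))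
      obtain ⟨f₁, h₁, f₂, h₂, rfl⟩ := Submodule.mem_sup.1 (hsplit hf)
      refine ⟨⟨f₁, h₁⟩, ?_⟩
      rw [map_add, map_add, (hker f₂).2 h₂, add_zero]
      rfl
  rw [← hrange, LinearMap.finrank_range_of_inj hinj, finrank_restrictSupport]

variable [Fintype σ]

theorem finite_standardExponents (μ : ι → σ →₀ ℕ) (T : Set ι) (t : ℕ) :
    (standardExponents μ T t).Finite :=
  (Finsupp.finite_of_degree_eq t).subset fun _ h => h.1

/-- The generating function of the numbers of standard monomials. -/
def standardSeries (μ : ι → σ →₀ ℕ) (T : Set ι) : PowerSeries ℚ :=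
  PowerSeries.mk fun t => ((standardExponents μ T t).ncard : ℚ)

theorem standardSeries_empty [Nonempty σ] (μ : ι → σ →₀ ℕ) :
    standardSeries μ ∅ = (PowerSeries.invOneSubPow ℚ (Fintype.card σ)).val := by
  classical
  rw [PowerSeries.invOneSubPow_val_eq_mk_sub_one_add_choose_of_pos _ _ Fintype.card_pos]
  ext t
  simp only [standardSeries, PowerSeries.coeff_mk, Nat.cast_inj]
  have : standardExponents μ ∅ t = ((Finset.univ : Finset σ).finsuppAntidiag t : Set (σ →₀ ℕ)) := by
    ext γ
    simp [standardExponents, divisibleExponents, Finset.mem_finsuppAntidiag,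
      Finsupp.degree_eq_sum]
  rw [this, Set.ncard_coe_finset, Finset.card_finsuppAntidiag_nat_eq_choose, Finset.card_univ]
  have := Fintype.card_pos (α := σ)
  rw [← Nat.choose_symm_of_eq_add (n := Fintype.card σ - 1 + t) (a := t) (by omega)]
  congr 1
  omega

/-- The monomials that are divisible by `μ p` but by no `μ p'` with `p' ∈ T` are the multiples
by `μ p` of the monomials divisible by no `μ p'` with `p' ∈ T`. -/
theorem standardSeries_insert {μ : ι → σ →₀ ℕ} (hμ : IsCoprimeFamily μ)
    (hdeg : ∀ p, (μ p).degree = 2) {T : Set ι} {p : ι} (hp : p ∉ T) :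
    standardSeries μ (insert p T) = (1 - PowerSeries.X ^ 2) * standardSeries μ T := by
  have hmem : ∀ γ, γ + μ p ∈ divisibleExponents μ T ↔ γ ∈ divisibleExponents μ T := fun γ => by
    refine exists_congr fun p' => and_congr_right fun hp' =>
      le_add_iff_of_disjoint (hμ.disjoint p' p ?_) γ
    rintro rfl
    exact hp hp'
  have hins : ∀ γ, γ ∈ divisibleExponents μ (insert p T) ↔
      μ p ≤ γ ∨ γ ∈ divisibleExponents μ T := fun γ => by
    simp [divisibleExponents]
  ext t
  rw [sub_mul, one_mul, map_sub, PowerSeries.coeff_X_pow_mul']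
  simp only [standardSeries, PowerSeries.coeff_mk]
  split_ifs with ht
  · have hunion : standardExponents μ T t = standardExponents μ (insert p T) t ∪
        (· + μ p) '' standardExponents μ T (t - 2) := by
      ext γ
      simp only [standardExponents, Set.mem_union, Set.mem_image, Set.mem_ofPred_eq, hins]
      constructor
      · rintro ⟨h1, h2⟩
        by_cases h : μ p ≤ γ
        · refine Or.inr ⟨γ - μ p, ⟨?_, ?_⟩, tsub_add_cancel_of_le h⟩
          · have : (γ - μ p).degree + (μ p).degree = γ.degree := by
              rw [← map_add, tsub_add_cancel_of_le h]
            rw [hdeg] at this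
            omega
          · rwa [← hmem, tsub_add_cancel_of_le h]
        · exact Or.inl ⟨h1, not_or.2 ⟨h, h2⟩⟩
      · rintro (⟨h1, h2⟩ | ⟨δ, ⟨h1, h2⟩, rfl⟩)
        · exact ⟨h1, fun h => h2 (Or.inr h)⟩
        · refine ⟨?_, (hmem δ).not.2 h2⟩
          rw [map_add, hdeg, h1]
          omega
    have hdisj : Disjoint (standardExponents μ (insert p T) t)
        ((· + μ p) '' standardExponents μ T (t - 2)) := by
      rw [Set.disjoint_left]
      rintro _ h ⟨δ, -, rfl⟩
      exact h.2 ((hins _).2 (Or.inl le_add_self))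
    rw [hunion, Set.ncard_union_eq hdisj (finite_standardExponents _ _ _)
      ((finite_standardExponents _ _ _).image _),
      Set.ncard_image_of_injective _ (add_left_injective _)]
    push_cast
    ring
  · rw [sub_zero, Nat.cast_inj]
    congr 1
    ext γ
    simp only [standardExponents, Set.mem_ofPred_eq, hins]
    refine and_congr_right fun h => not_congr (or_iff_right fun hle => ?_)
    have := Finsupp.degree_mono hle
    rw [hdeg] at this
    omega

theorem standardSeries_univ [Nonempty σ] [Fintype ι] {μ : ι → σ →₀ ℕ} (hμ : IsCoprimeFamily μ)
    (hdeg : ∀ p, (μ p).degree = 2) :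
    standardSeries μ Set.univ =
      (1 - PowerSeries.X ^ 2) ^ Fintype.card ι *
        (PowerSeries.invOneSubPow ℚ (Fintype.card σ)).val := by
  classical
  have h : ∀ T : Finset ι, standardSeries μ (T : Set ι) = (1 - PowerSeries.X ^ 2) ^ T.card *
        (PowerSeries.invOneSubPow ℚ (Fintype.card σ)).val := by
    intro T
    induction T using Finset.induction_on with
    | empty => simp [standardSeries_empty]
    | insert p T hp ih =>
      rw [Finset.coe_insert, standardSeries_insert hμ hdeg (by simpa using hp), ih,
        Finset.card_insert_of_notMem hp, pow_succ]
      ring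
  simpa using h Finset.univ

theorem leadingCoeff_hilbertPoly {p : Polynomial ℚ} (hp : p.eval 1 ≠ 0) (e : ℕ) :
    (p.hilbertPoly (e + 1)).natDegree = e ∧
      (p.hilbertPoly (e + 1)).leadingCoeff = p.eval 1 * (e ! : ℚ)⁻¹ := by
  have hc : (p.hilbertPoly (e + 1)).coeff e = p.eval 1 * (e ! : ℚ)⁻¹ := by
    rw [Polynomial.hilbertPoly_succ, Polynomial.finsetSum_coeff, Polynomial.eval_eq_sum,
      Polynomial.sum_def, Finset.sum_mul]
    simp [Polynomial.coeff_preHilbertPoly_self]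
  have hd : (p.hilbertPoly (e + 1)).natDegree = e := by
    refine Polynomial.natDegree_eq_of_le_of_coeff_ne_zero ?_ ?_
    · rw [Polynomial.hilbertPoly_succ]
      refine Polynomial.natDegree_sum_le_of_forall_le _ _ fun i _ => ?_
      exact (Polynomial.natDegree_smul_le _ _).trans (Polynomial.natDegree_preHilbertPoly ℚ e i).le
    · rw [hc]
      exact mul_ne_zero hp (inv_ne_zero (Nat.cast_ne_zero.2 (Nat.factorial_ne_zero e)))
  exact ⟨hd, by rw [Polynomial.leadingCoeff, hd, hc]⟩

/-- The Hilbert series is `(1 + X) ^ m / (1 - X) ^ (N - m)`, so the degree is the value of the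
numerator at `1`. -/
theorem hilbertFunctionHasDegree_standardExponents [Fintype ι] {μ : ι → σ →₀ ℕ}
    (hμ : IsCoprimeFamily μ) (hdeg : ∀ p, (μ p).degree = 2)
    (hcard : Fintype.card ι < Fintype.card σ) :
    HilbertFunctionHasDegree (fun t => (standardExponents μ Set.univ t).ncard)
      (2 ^ Fintype.card ι) := by
  have : Nonempty σ := Fintype.card_pos_iff.1 (by omega)
  obtain ⟨e, he⟩ := Nat.exists_eq_add_of_lt hcard
  set m := Fintype.card ι
  have hp : ((1 + Polynomial.X : Polynomial ℚ) ^ m).eval 1 = 2 ^ m := by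
    simp [one_add_one_eq_two]
  obtain ⟨hd, hl⟩ := leadingCoeff_hilbertPoly (p := (1 + Polynomial.X : Polynomial ℚ) ^ m)
    (by rw [hp]; positivity) e
  have hseries : standardSeries μ Set.univ =
      (((1 + Polynomial.X : Polynomial ℚ) ^ m : Polynomial ℚ) : PowerSeries ℚ) *
        (PowerSeries.invOneSubPow ℚ (e + 1)).val := by
    rw [standardSeries_univ hμ hdeg, he,
      ← PowerSeries.one_sub_pow_mul_invOneSubPow_val_add_eq_invOneSubPow_val ℚ (e + 1) m,
      show e + 1 + m = m + e + 1 by ring]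
    push_cast
    rw [← mul_assoc, ← mul_pow]
    congr 2
    ring
  refine ⟨((1 + Polynomial.X : Polynomial ℚ) ^ m).hilbertPoly (e + 1), eventually_atTop.2
    ⟨((1 + Polynomial.X : Polynomial ℚ) ^ m).natDegree + 1, fun t ht => ?_⟩, ?_⟩
  · rw [← Polynomial.coeff_mul_invOneSubPow_eq_hilbertPoly_eval (e + 1) (by omega), ← hseries,
      standardSeries, PowerSeries.coeff_mk]
  · rw [hd, hl, hp]
    have : (e ! : ℚ) ≠ 0 := Nat.cast_ne_zero.2 (Nat.factorial_ne_zero e)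
    push_cast
    field_simp

end HilbertFunction

/-! ### Krull dimension of a complete intersection -/

section KrullDimension

variable {σ ι : Type*} [Fintype σ] [Fintype ι]

theorem ringKrullDim_quotient_add_one_le {R : Type*} [CommRing R] {J J' : Ideal R} {f : R}
    (hJ : J' = J ⊔ Ideal.span {f}) (hf : ∀ g, f * g ∈ J → g ∈ J) :
    ringKrullDim (R ⧸ J') + 1 ≤ ringKrullDim (R ⧸ J) := by
  have hreg : Ideal.Quotient.mk J f ∈ nonZeroDivisors (R ⧸ J) := by
    rw [mem_nonZeroDivisors_iff_left]
    intro x hx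
    obtain ⟨x, rfl⟩ := Ideal.Quotient.mk_surjective x
    rw [← map_mul, Ideal.Quotient.eq_zero_iff_mem] at hx
    exact Ideal.Quotient.eq_zero_iff_mem.2 (hf x hx)
  have h := ringKrullDim_quotient_succ_le_of_nonZeroDivisor hreg
  have e : (R ⧸ J') ≃+* ((R ⧸ J) ⧸ Ideal.span {Ideal.Quotient.mk J f}) := by
    subst hJ
    refine (DoubleQuot.quotQuotEquivQuotSup J (Ideal.span {f})).symm.trans
      (Ideal.quotEquivOfEq ?_)
    rw [Ideal.map_span, Set.image_singleton]
  rwa [← ringKrullDim_eq_of_ringEquiv e] at h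

theorem ringKrullDim_mvPolynomial_field {K : Type*} [Field K] :
    ringKrullDim (MvPolynomial σ K) = Fintype.card σ := by
  rw [MvPolynomial.ringKrullDim_of_isNoetherianRing, ringKrullDim_eq_zero_of_field, zero_add,
    Nat.card_eq_fintype_card]

theorem ringKrullDim_quotient_add_card_le {K : Type*} [Field K] {μ : ι → σ →₀ ℕ}
    {q : ι → MvPolynomial σ K} (hμ : IsCoprimeFamily μ) {w : σ → ℕ}
    (hq : ∀ p, HasLeadingMonomial w (q p) (μ p)) :
    ringKrullDim (MvPolynomial σ K ⧸ Ideal.span (Set.range q)) + (Fintype.card ι : WithBot ℕ∞) ≤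
      Fintype.card σ := by
  classical
  have h : ∀ T : Finset ι, ringKrullDim (MvPolynomial σ K ⧸ Ideal.span (q '' T)) +
      (T.card : WithBot ℕ∞) ≤ Fintype.card σ := by
    intro T
    induction T using Finset.induction_on with
    | empty =>
      rw [← ringKrullDim_mvPolynomial_field (σ := σ) (K := K), Finset.card_empty, Nat.cast_zero,
        add_zero]
      exact ringKrullDim_quotient_le _
    | insert p T hp ih =>
      refine le_trans ?_ ih
      rw [Finset.card_insert_of_notMem hp, Nat.cast_add, Nat.cast_one,
        add_comm (T.card : WithBot ℕ∞), ← add_assoc]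
      gcongr
      refine ringKrullDim_quotient_add_one_le (f := q p) ?_ fun g hg =>
        mem_span_of_mul_mem_span hμ hq (by simpa using hp) hg
      rw [Finset.coe_insert, Set.image_insert_eq, Set.insert_eq, Ideal.span_union, sup_comm]
  have := h Finset.univ
  rwa [Finset.coe_univ, Set.image_univ, Finset.card_univ] at this

/-- The maximal ideal of the origin has maximal height, since translations act transitively on the
points. -/
theorem height_vanishingIdeal_zero :
    ((vanishingIdeal ℂ {(0 : σ → ℂ)}).height : WithBot ℕ∞) = Fintype.card σ := by
  have hdim : ringKrullDim (MvPolynomial σ ℂ) = Fintype.card σ := ringKrullDim_mvPolynomial_field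
  have : FiniteRingKrullDim (MvPolynomial σ ℂ) := by
    rw [finiteRingKrullDim_iff_ne_bot_and_top, hdim]
    exact ⟨WithBot.natCast_ne_bot _, fun h => ENat.natCast_ne_top _ (WithBot.coe_injective h)⟩
  obtain ⟨m, hm, hh⟩ := Ideal.exists_isMaximal_height (R := MvPolynomial σ ℂ)
  obtain ⟨x, rfl⟩ := isMaximal_iff_eq_vanishingIdeal_singleton.1 hm
  have e1 : ∀ y : σ → ℂ, (aeval fun i => X i - C (y i) : MvPolynomial σ ℂ →ₐ[ℂ] _).comp
      (aeval fun i => X i + C (y i)) = AlgHom.id ℂ _ := fun y => by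
    ext i; simp [algebraMap_eq]
  have e2 : ∀ y : σ → ℂ, (aeval fun i => X i + C (y i) : MvPolynomial σ ℂ →ₐ[ℂ] _).comp
      (aeval fun i => X i - C (y i)) = AlgHom.id ℂ _ := fun y => by
    ext i; simp [algebraMap_eq]
  let e : MvPolynomial σ ℂ ≃ₐ[ℂ] MvPolynomial σ ℂ := AlgEquiv.ofAlgHom _ _ (e2 x) (e1 x)
  have hcomap : (vanishingIdeal ℂ {(0 : σ → ℂ)}).comap e.toRingEquiv = vanishingIdeal ℂ {x} := by
    ext f
    rw [Ideal.mem_comap, mem_vanishingIdeal_singleton_iff, mem_vanishingIdeal_singleton_iff]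
    have : (aeval (0 : σ → ℂ)).comp (aeval fun i => X i + C (x i) : MvPolynomial σ ℂ →ₐ[ℂ] _) =
        aeval x := by
      ext i; simp
    exact Eq.congr (DFunLike.congr_fun this f) rfl
  rw [← RingEquiv.height_comap e.toRingEquiv, hcomap, hh, hdim]

theorem card_le_ringKrullDim_quotient_add_card {q : ι → MvPolynomial σ ℂ}
    (h0 : ∀ p, eval 0 (q p) = 0) :
    (Fintype.card σ : WithBot ℕ∞) ≤
      ringKrullDim (MvPolynomial σ ℂ ⧸ Ideal.span (Set.range q)) + Fintype.card ι := by
  have hmax : (vanishingIdeal ℂ {(0 : σ → ℂ)}).IsMaximal :=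
    isMaximal_iff_eq_vanishingIdeal_singleton.2 ⟨0, rfl⟩
  have h := Ideal.height_le_ringKrullDim_quotient_add_encard
    (p := vanishingIdeal ℂ {(0 : σ → ℂ)}) (Set.range q) (by
      rintro _ ⟨p, rfl⟩
      rw [SetLike.mem_coe, mem_vanishingIdeal_singleton_iff]
      exact h0 p)
  rw [height_vanishingIdeal_zero] at h
  refine h.trans ?_
  gcongr
  have : (Set.range q).encard ≤ Fintype.card ι := by
    rw [← Set.image_univ]
    refine (Set.encard_image_le _ _).trans ?_
    simp
  exact_mod_cast this

end KrullDimension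

/-! ### The Cayley parametrization -/

section Cayley

variable {k n : ℕ} {S : Type*} [CommRing S]

/-- The `k × n` matrix `(1 | 0)`. -/
def headMatrix (k n : ℕ) (S : Type*) [CommRing S] : Matrix (Fin k) (Fin n) S :=
  Matrix.of fun i l => if (i : ℕ) = l then 1 else 0

theorem mul_headMatrix_transpose (hkn : k ≤ n) (A : Matrix (Fin k) (Fin n) S) :
    A * (headMatrix k n S)ᵀ = Matrix.of fun i j => A i (Fin.castLE hkn j) := by
  ext i j
  rw [Matrix.mul_apply, Finset.sum_eq_single (Fin.castLE hkn j)]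
  · simp [headMatrix]
  · intro l _ hl
    have : (j : ℕ) ≠ l := fun h => hl (Fin.ext (by simp [h]))
    simp [headMatrix, this]
  · simp

theorem headMatrix_mul_transpose (hkn : k ≤ n) :
    headMatrix k n S * (headMatrix k n S)ᵀ = 1 := by
  rw [mul_headMatrix_transpose hkn]
  ext i j
  simp [headMatrix, Matrix.one_apply, Fin.ext_iff]

/-- The Cayley parametrization produces points with `A Aᵀ = z²`. -/
theorem mul_transpose_of_cayley (hkn : k ≤ n) {T T' D : Matrix (Fin k) (Fin k) S}
    {W : Matrix (Fin k) (Fin n) S} (z : S) (hT : T' * T = 1) (hD : D * Dᵀ = 1)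
    (hW : W * (headMatrix k n S)ᵀ = 1) (hTW : T + Tᵀ = W * Wᵀ) :
    (z • (D * (T' * W - headMatrix k n S))) * (z • (D * (T' * W - headMatrix k n S)))ᵀ =
      z ^ 2 • (1 : Matrix (Fin k) (Fin k) S) := by
  set E := headMatrix k n S
  have hE : E * Eᵀ = 1 := headMatrix_mul_transpose hkn
  have hW' : E * Wᵀ = 1 := by
    simpa using congrArg Matrix.transpose hW
  have hT' : Tᵀ * T'ᵀ = 1 := by
    simpa using congrArg Matrix.transpose hT
  have key : (T' * W - E) * (T' * W - E)ᵀ = 1 := by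
    calc (T' * W - E) * (T' * W - E)ᵀ
        = T' * (W * Wᵀ) * T'ᵀ - T' * (W * Eᵀ) - (E * Wᵀ) * T'ᵀ + E * Eᵀ := by
          simp only [Matrix.transpose_sub, Matrix.transpose_mul, Matrix.sub_mul, Matrix.mul_sub,
            Matrix.mul_assoc]
          abel
      _ = (T' * T) * T'ᵀ + T' * (Tᵀ * T'ᵀ) - T' - T'ᵀ + 1 := by
          rw [← hTW, hW, hW', hE, Matrix.mul_add, Matrix.add_mul, Matrix.mul_one, Matrix.one_mul,
            Matrix.mul_assoc T' Tᵀ]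
      _ = 1 := by
          rw [hT, hT', Matrix.mul_one, Matrix.one_mul]
          abel
  rw [Matrix.transpose_smul, Matrix.smul_mul, Matrix.mul_smul, smul_smul, Matrix.transpose_mul,
    Matrix.mul_assoc, ← Matrix.mul_assoc _ _ Dᵀ, key, Matrix.one_mul, hD, pow_two]

/-- The inverse of the Cayley parametrization: with `T` the inverse of `1 + z⁻¹ D U`, where `U` is
the left `k × k` block of `A`, the matrix `W = T (z⁻¹ D A + (1 | 0))` has left block `1`, the
symmetric part of `T` is determined by `W`, and `A` is recovered from `T` and `W`. -/
theorem cayley_of_mul_transpose (hkn : k ≤ n) {T D : Matrix (Fin k) (Fin k) S}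
    {A : Matrix (Fin k) (Fin n) S} {z z' : S} (hz : z * z' = 1) (hD : D * D = 1) (hD' : Dᵀ = D)
    (hA : A * Aᵀ = z ^ 2 • (1 : Matrix (Fin k) (Fin k) S))
    (hT : T * (1 + z' • (D * A * (headMatrix k n S)ᵀ)) = 1) :
    T * (z' • (D * A) + headMatrix k n S) * (headMatrix k n S)ᵀ = 1 ∧
    T + Tᵀ = (T * (z' • (D * A) + headMatrix k n S)) *
      (T * (z' • (D * A) + headMatrix k n S))ᵀ ∧
    z • (D * ((1 + z' • (D * A * (headMatrix k n S)ᵀ)) *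
      (T * (z' • (D * A) + headMatrix k n S)) - headMatrix k n S)) = A := by
  set E := headMatrix k n S
  have hE : E * Eᵀ = 1 := headMatrix_mul_transpose hkn
  set P := 1 + z' • (D * A * Eᵀ) with hP
  have hPT : P * T = 1 := mul_eq_one_comm.1 hT
  have hB : (z' • (D * A)) * (z' • (D * A))ᵀ = 1 := by
    rw [Matrix.transpose_smul, Matrix.smul_mul, Matrix.mul_smul, smul_smul, Matrix.transpose_mul,
      Matrix.mul_assoc, ← Matrix.mul_assoc A, hA, hD', Matrix.smul_mul, Matrix.mul_smul,
      Matrix.one_mul, hD, smul_smul,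
      show z' * z' * z ^ 2 = (z * z') ^ 2 by ring, hz, one_pow, one_smul]
  have hBE : (z' • (D * A)) * Eᵀ = P - 1 := by
    rw [hP, Matrix.smul_mul]
    abel
  have hEB : E * (z' • (D * A))ᵀ = Pᵀ - 1 := by
    simpa using congrArg Matrix.transpose hBE
  have hTP' : Pᵀ * Tᵀ = 1 := by
    simpa using congrArg Matrix.transpose hT
  set B := z' • (D * A) with hBdef
  refine ⟨?_, ?_, ?_⟩
  · rw [Matrix.mul_assoc, Matrix.add_mul, hBE, hE, sub_add_cancel, hT]
  · have hsum : (B + E) * (B + E)ᵀ = P + Pᵀ := by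
      rw [Matrix.transpose_add, Matrix.add_mul, Matrix.mul_add, Matrix.mul_add, hB, hBE, hEB, hE]
      abel
    rw [Matrix.transpose_mul, Matrix.mul_assoc, ← Matrix.mul_assoc _ _ Tᵀ, hsum, Matrix.add_mul,
      hTP', Matrix.mul_add, ← Matrix.mul_assoc, hT, Matrix.one_mul, Matrix.mul_one, add_comm]
  · rw [← Matrix.mul_assoc, hPT, Matrix.one_mul, add_sub_cancel_right, hBdef, Matrix.mul_smul,
      ← Matrix.mul_assoc, hD, Matrix.one_mul, smul_smul, hz, one_smul]

variable [Algebra ℂ S]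

/-- The matrix with left block `1` and the remaining entries taken from `y`. -/
def cayleyW (y : Matrix (Fin k) (Fin n) S) : Matrix (Fin k) (Fin n) S :=
  Matrix.of fun i l => if (l : ℕ) < k then headMatrix k n S i l else y i l

/-- The matrix with symmetric part `W Wᵀ / 2` and skew-symmetric part `κ - κᵀ`. -/
def cayleyT (κ : Matrix (Fin k) (Fin k) S) (y : Matrix (Fin k) (Fin n) S) :
    Matrix (Fin k) (Fin k) S :=
  (1 / 2 : ℂ) • (cayleyW y * (cayleyW y)ᵀ) + (κ - κᵀ)

omit [Algebra ℂ S] in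
theorem cayleyW_mul_headMatrix_transpose (hkn : k ≤ n) (y : Matrix (Fin k) (Fin n) S) :
    cayleyW y * (headMatrix k n S)ᵀ = 1 := by
  rw [← headMatrix_mul_transpose hkn, mul_headMatrix_transpose hkn, mul_headMatrix_transpose hkn]
  ext i j
  simp [cayleyW]

omit [Algebra ℂ S] in
theorem cayleyW_eq_self (hkn : k ≤ n) {W : Matrix (Fin k) (Fin n) S}
    (hW : W * (headMatrix k n S)ᵀ = 1) : cayleyW W = W := by
  rw [← headMatrix_mul_transpose hkn, mul_headMatrix_transpose hkn,
    mul_headMatrix_transpose hkn] at hW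
  ext i l
  simp only [cayleyW, Matrix.of_apply]
  split_ifs with h
  · exact (congrFun (congrFun hW i) ⟨l, h⟩).symm
  · rfl

theorem half_smul_add_self {M : Type*} [AddCommGroup M] [Module ℂ M] (x : M) :
    (1 / 2 : ℂ) • x + (1 / 2 : ℂ) • x = x := by
  rw [← add_smul, add_halves, one_smul]

theorem cayleyT_add_transpose (κ : Matrix (Fin k) (Fin k) S) (y : Matrix (Fin k) (Fin n) S) :
    cayleyT κ y + (cayleyT κ y)ᵀ = cayleyW y * (cayleyW y)ᵀ := by
  conv_rhs => rw [← half_smul_add_self (cayleyW y * (cayleyW y)ᵀ)]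
  simp only [cayleyT, Matrix.transpose_add, Matrix.transpose_smul, Matrix.transpose_sub,
    Matrix.transpose_mul, Matrix.transpose_transpose]
  abel

theorem cayleyT_eq_self (hkn : k ≤ n) {T : Matrix (Fin k) (Fin k) S}
    {W : Matrix (Fin k) (Fin n) S} (hW : W * (headMatrix k n S)ᵀ = 1) (hTW : T + Tᵀ = W * Wᵀ) :
    cayleyT ((1 / 2 : ℂ) • T) W = T := by
  rw [cayleyT, cayleyW_eq_self hkn hW, ← hTW, Matrix.transpose_smul, smul_add]
  conv_rhs => rw [← half_smul_add_self T]
  abel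

variable {S' : Type*} [CommRing S'] [Algebra ℂ S'] (α : S →ₐ[ℂ] S')

theorem headMatrix_map : (headMatrix k n S).map α = headMatrix k n S' := by
  ext i l
  simp [headMatrix, apply_ite α]

theorem cayleyW_map (y : Matrix (Fin k) (Fin n) S) : (cayleyW y).map α = cayleyW (y.map α) := by
  ext i l
  simp [cayleyW, headMatrix, apply_ite α]

theorem cayleyT_map (κ : Matrix (Fin k) (Fin k) S) (y : Matrix (Fin k) (Fin n) S) :
    (cayleyT κ y).map α = cayleyT (κ.map α) (y.map α) := by
  ext i j
  simp [cayleyT, ← cayleyW_map, Matrix.mul_apply]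

end Cayley

/-! ### Sign averaging of determinants -/

section SignSum

variable {k : ℕ} {S : Type*} [CommRing S]

/-- The diagonal matrix with diagonal entries `ε i = ±1`. -/
def signMatrix (S : Type*) [CommRing S] (ε : Fin k → ℤˣ) : Matrix (Fin k) (Fin k) S :=
  Matrix.diagonal fun i => ((ε i : ℤ) : S)

theorem signMatrix_mul_self (ε : Fin k → ℤˣ) : signMatrix S ε * signMatrix S ε = 1 := by
  rw [signMatrix, Matrix.diagonal_mul_diagonal, ← Matrix.diagonal_one]
  congr 1
  ext i
  rw [← Int.cast_mul, ← Units.val_mul, Int.units_mul_self]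
  simp

theorem signMatrix_transpose (ε : Fin k → ℤˣ) : (signMatrix S ε)ᵀ = signMatrix S ε :=
  Matrix.diagonal_transpose _

theorem signMatrix_map {S' F : Type*} [CommRing S'] [FunLike F S S'] [RingHomClass F S S'] (α : F)
    (ε : Fin k → ℤˣ) : (signMatrix S ε).map α = signMatrix S' ε := by
  rw [signMatrix, Matrix.diagonal_map (map_zero α), signMatrix]
  simp

theorem sum_sign_mul_prod (s : Finset (Fin k)) :
    ∑ ε : Fin k → ℤˣ, (∏ i, ((ε i : ℤ) : S)) * ∏ i ∈ s, ((ε i : ℤ) : S) =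
      if s = Finset.univ then 2 ^ k else 0 := by
  have h1 : ∀ ε : Fin k → ℤˣ, (∏ i, ((ε i : ℤ) : S)) * ∏ i ∈ s, ((ε i : ℤ) : S) =
      ∏ i, (((ε i : ℤ) : S) * if i ∈ s then ((ε i : ℤ) : S) else 1) := fun ε => by
    rw [Finset.prod_mul_distrib, Finset.prod_ite_mem, Finset.univ_inter]
  have h2 := Finset.prod_univ_sum (fun _ : Fin k => (Finset.univ : Finset ℤˣ))
    (fun i e => (((e : ℤ) : S) * if i ∈ s then ((e : ℤ) : S) else 1))
  rw [Fintype.piFinset_univ] at h2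
  simp only [h1]
  rw [← h2]
  have h3 : ∀ i, ∑ e : ℤˣ, (((e : ℤ) : S) * if i ∈ s then ((e : ℤ) : S) else 1) =
      if i ∈ s then 2 else 0 := fun i => by
    rw [UnitsInt.univ, Finset.sum_pair (by decide)]
    split_ifs <;> norm_num
  simp only [h3]
  split_ifs with h
  · simp [h]
  · obtain ⟨i, hi⟩ : ∃ i, i ∉ s := by
      by_contra! hs
      exact h (Finset.eq_univ_iff_forall.2 hs)
    exact Finset.prod_eq_zero (Finset.mem_univ i) (by simp [hi])

/-- The determinant of `z D + U` is affine-linear in each diagonal entry of `D`, so averaging over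
all signs extracts its top coefficient. -/
theorem sum_sign_mul_det (U : Matrix (Fin k) (Fin k) S) (z : S) :
    ∑ ε : Fin k → ℤˣ, (∏ i, ((ε i : ℤ) : S)) * (z • signMatrix S ε + U).det = 2 ^ k * z ^ k := by
  set d : Finset (Fin k) → S := fun s =>
    Matrix.detRowAlternating (s.piecewise (fun i => Pi.single i (1 : S)) fun i => U i) with hd
  have hdet : ∀ ε : Fin k → ℤˣ, (z • signMatrix S ε + U).det =
      ∑ s : Finset (Fin k), (∏ i ∈ s, ((ε i : ℤ) : S)) * (z ^ s.card * d s) := fun ε => by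
    have h := (Matrix.detRowAlternating (n := Fin k) (R := S)).toMultilinearMap.map_add_univ
      (fun i => Pi.single i (z * ((ε i : ℤ) : S))) fun i => U i
    have h0 : z • signMatrix S ε + U =
        (fun i => Pi.single i (z * ((ε i : ℤ) : S)) : Fin k → Fin k → S) + fun i => U i := by
      ext i j
      simp [signMatrix, Matrix.diagonal_apply, Pi.single_apply, eq_comm]
    rw [Matrix.det, h0]
    refine h.trans (Finset.sum_congr rfl fun s _ => ?_)
    have h' := (Matrix.detRowAlternating (n := Fin k) (R := S)).toMultilinearMap.map_piecewise_smul
      (fun i => z * ((ε i : ℤ) : S)) (s.piecewise (fun i => Pi.single i (1 : S)) fun i => U i) s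
    rw [Finset.prod_mul_distrib, Finset.prod_const, smul_eq_mul] at h'
    rw [← mul_assoc, mul_comm (∏ i ∈ s, _), hd]
    refine Eq.trans ?_ h'
    congr 1
    ext i j
    by_cases hi : i ∈ s
    · simp [hi, Pi.single_apply]
    · simp [hi]
  simp only [hdet, Finset.mul_sum]
  rw [Finset.sum_comm]
  simp only [← mul_assoc, ← Finset.sum_mul, sum_sign_mul_prod]
  rw [Finset.sum_eq_single Finset.univ]
  · have : d Finset.univ = 1 := by
      simp only [hd, Finset.piecewise_univ]
      refine Eq.trans (congrArg Matrix.det ?_) Matrix.det_one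
      ext i j
      simp [Matrix.one_apply, Pi.single_apply, eq_comm]
    simp [this]
  · intro s _ hs
    simp [hs]
  · simp

end SignSum

/-! ### Leading monomials of the quadrics -/

section Leading

variable {k n : ℕ}

/-- The column `i + j` containing the leading monomial of the quadric with index `(i, j)`. -/
def leadingColumn (hkn : 2 * k ≤ n + 1) (p : UpperIndex k) : Fin n :=
  ⟨p.1.1 + p.1.2, by have := p.1.1.2; have := p.1.2.2; omega⟩

/-- The leading monomial `a_{i,i+j} a_{j,i+j}` of the quadric with index `(i, j)`. -/
def leadingExponent (hkn : 2 * k ≤ n + 1) (p : UpperIndex k) : Coord k n →₀ ℕ :=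
  Finsupp.single (some (p.1.1, leadingColumn hkn p)) 1 +
    Finsupp.single (some (p.1.2, leadingColumn hkn p)) 1

/-- The weight `4 i l + n² - l²` of the entry `(i, l)`, and the weight `0` of the coordinate `z₀`.
Since `a_{i,l} a_{j,l}` has weight `2 n² + 2 (i + j)² - 2 (l - (i + j))²`, it is the heaviest
when `l = i + j`. -/
def leadingWeight (k n : ℕ) : Coord k n → ℕ
  | none => 0
  | some (i, l) => 4 * i * l + (n - l) * (n + l)

theorem leadingWeight_add (i j : Fin k) (l : Fin n) :
    ((leadingWeight k n (some (i, l)) + leadingWeight k n (some (j, l)) : ℕ) : ℤ) =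
      2 * (n : ℤ) ^ 2 + 2 * (i + j : ℤ) ^ 2 - 2 * (l - (i + j) : ℤ) ^ 2 := by
  simp only [leadingWeight]
  push_cast [Nat.cast_sub l.2.le]
  ring

theorem mem_support_leadingExponent (hkn : 2 * k ≤ n + 1) (p : UpperIndex k) (s : Coord k n) :
    s ∈ (leadingExponent hkn p).support ↔
      s = some (p.1.1, leadingColumn hkn p) ∨ s = some (p.1.2, leadingColumn hkn p) := by
  rw [Finsupp.mem_support_iff, leadingExponent, Finsupp.add_apply, Finsupp.single_apply,
    Finsupp.single_apply, Ne, Nat.add_eq_zero_iff]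
  simp only [ite_eq_right_iff, one_ne_zero, imp_false, not_and_or, not_not]
  exact or_congr eq_comm eq_comm

theorem degree_leadingExponent (hkn : 2 * k ≤ n + 1) (p : UpperIndex k) :
    (leadingExponent hkn p).degree = 2 := by
  simp [leadingExponent]

/-- The factor `a_{i,l}` of a leading monomial determines the other factor `a_{l-i,l}`. -/
theorem isCoprimeFamily_leadingExponent (hkn : 2 * k ≤ n + 1) :
    IsCoprimeFamily (leadingExponent hkn) where
  ne_zero p h := by
    have := degree_leadingExponent hkn p
    simp [h] at this
  disjoint p q hpq := by
    rw [Finset.disjoint_left]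
    intro s hp hq
    rw [mem_support_leadingExponent] at hp hq
    apply hpq
    have hpp : (p.1.1 : ℕ) ≤ p.1.2 := p.2
    have hqq : (q.1.1 : ℕ) ≤ q.1.2 := q.2
    refine Subtype.ext (Prod.ext (Fin.ext ?_) (Fin.ext ?_)) <;>
    · rcases hp with rfl | rfl <;> rcases hq with hq | hq <;>
      · simp only [leadingColumn, Option.some.injEq, Prod.mk.injEq, Fin.ext_iff] at hq
        omega

theorem hasLeadingMonomial_quadric (hkn : 2 * k ≤ n + 1) (p : UpperIndex k) :
    HasLeadingMonomial (leadingWeight k n) (quadric k n p) (leadingExponent hkn p) := by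
  have hpair : ∀ l : Fin n, (X (some (p.1.1, l)) * X (some (p.1.2, l)) :
      MvPolynomial (Coord k n) ℂ) =
      monomial (Finsupp.single (some (p.1.1, l)) 1 + Finsupp.single (some (p.1.2, l)) 1) 1 :=
    fun l => by simp [X]
  have hw := leadingWeight_add p.1.1 p.1.2 (leadingColumn hkn p)
  have hlead : Finsupp.weight (leadingWeight k n) (leadingExponent hkn p) =
      leadingWeight k n (some (p.1.1, leadingColumn hkn p)) +
        leadingWeight k n (some (p.1.2, leadingColumn hkn p)) := by
    simp [leadingExponent, Finsupp.weight_apply, Finsupp.sum_add_index', add_mul]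
  rw [← hlead] at hw
  have hcol : ((leadingColumn hkn p : ℕ) : ℤ) = p.1.1 + p.1.2 := by simp [leadingColumn]
  rw [hcol, sub_self, zero_pow two_ne_zero, mul_zero, sub_zero, leadingExponent] at hw
  rw [HasLeadingMonomial, quadric, leadingExponent, ← hpair,
    ← Finset.add_sum_erase _ _ (Finset.mem_univ (leadingColumn hkn p)), add_sub_assoc,
    add_sub_cancel_left]
  refine sub_mem (sum_mem fun l hl => ?_) ?_
  · rw [hpair, monomial_mem_restrictSupport]
    refine Or.inl ⟨by simp, ?_⟩
    have hwl := leadingWeight_add p.1.1 p.1.2 l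
    have hweight : Finsupp.weight (leadingWeight k n)
        (Finsupp.single (some (p.1.1, l)) 1 + Finsupp.single (some (p.1.2, l)) 1) =
        leadingWeight k n (some (p.1.1, l)) + leadingWeight k n (some (p.1.2, l)) := by
      simp [Finsupp.weight_apply, Finsupp.sum_add_index', add_mul]
    rw [← hweight] at hwl
    have hne : (l : ℤ) - (p.1.1 + p.1.2) ≠ 0 := by
      intro h
      apply Finset.ne_of_mem_erase hl
      ext
      simp only [leadingColumn]
      omega
    have hpos : 0 < ((l : ℤ) - (p.1.1 + p.1.2)) ^ 2 := by positivity
    zify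
    rw [hw, hwl]
    linarith
  · split_ifs
    · rw [show (X none ^ 2 : MvPolynomial (Coord k n) ℂ) = monomial (Finsupp.single none 2) 1 by
        simp [X, monomial_pow], monomial_mem_restrictSupport]
      refine Or.inl ⟨by simp, ?_⟩
      have h0 : Finsupp.weight (leadingWeight k n) (Finsupp.single none 2) = 0 := by
        simp [Finsupp.weight_apply, leadingWeight]
      have hn : (0 : ℤ) < n := by
        have := (leadingColumn hkn p).2
        omega
      rw [h0]
      zify
      rw [hw]
      positivity
    · exact zero_mem _

end Leading

/-! ### The ideal of the quadrics is radical -/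

section Radical

variable {k n : ℕ}

/-- The ideal of the quadrics that define `Z(k,n)`. -/
def quadricIdeal (k n : ℕ) : Ideal (MvPolynomial (Coord k n) ℂ) :=
  Ideal.span (Set.range (quadric k n))

/-- The matrix of the coordinates `X (some (i, l))`. -/
def genericMatrix (k n : ℕ) : Matrix (Fin k) (Fin n) (MvPolynomial (Coord k n) ℂ) :=
  Matrix.of fun i l => X (some (i, l))

/-- The coordinate `z₀` is a nonzerodivisor modulo the quadrics: it divides none of the leading
monomials. -/
theorem mem_quadricIdeal_of_X_none_mul_mem (hkn : 2 * k ≤ n + 1)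
    {f : MvPolynomial (Coord k n) ℂ} (hf : X none * f ∈ quadricIdeal k n) :
    f ∈ quadricIdeal k n := by
  refine mem_span_of_X_mul_mem_span (isCoprimeFamily_leadingExponent hkn)
    (hasLeadingMonomial_quadric hkn) (fun p => ?_) hf
  rw [mem_support_leadingExponent]
  simp

theorem mem_quadricIdeal_of_X_none_pow_mul_mem (hkn : 2 * k ≤ n + 1)
    {f : MvPolynomial (Coord k n) ℂ} (a : ℕ) (hf : X none ^ a * f ∈ quadricIdeal k n) :
    f ∈ quadricIdeal k n := by
  induction a with
  | zero => simpa using hf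
  | succ a ih =>
    rw [pow_succ', mul_assoc] at hf
    exact ih (mem_quadricIdeal_of_X_none_mul_mem hkn hf)

variable {S : Type*} [CommRing S] [Algebra ℂ S]

/-- The quadrics vanish at a point with values in an algebra if and only if the point satisfies the
matrix equation. -/
theorem forall_map_quadric_eq_zero_iff (α : MvPolynomial (Coord k n) ℂ →ₐ[ℂ] S) :
    (∀ p, α (quadric k n p) = 0) ↔
      (genericMatrix k n).map α * ((genericMatrix k n).map α)ᵀ =
        α (X none) ^ 2 • (1 : Matrix (Fin k) (Fin k) S) := by
  have h : ∀ p, α (quadric k n p) = ((genericMatrix k n).map α * ((genericMatrix k n).map α)ᵀ -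
      α (X none) ^ 2 • (1 : Matrix (Fin k) (Fin k) S)) p.1.1 p.1.2 := fun p => by
    simp [quadric, Matrix.mul_apply, genericMatrix, Matrix.one_apply, apply_ite α]
  constructor
  · intro h0
    rw [← sub_eq_zero]
    ext i j
    rcases le_total i j with hij | hij
    · exact (h ⟨(i, j), hij⟩).symm.trans (h0 _)
    · rw [← Matrix.transpose_apply (_ - _) j i]
      simp only [Matrix.transpose_sub, Matrix.transpose_mul, Matrix.transpose_transpose,
        Matrix.transpose_smul, Matrix.transpose_one]
      exact (h ⟨(j, i), hij⟩).symm.trans (h0 _)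
  · intro h0 p
    rw [h, h0, sub_self, Matrix.zero_apply]

/-- The parameters of the Cayley parametrization: `z₀` and the entries of two matrices. -/
abbrev CayleyCoord (k n : ℕ) : Type := Option ((Fin k × Fin k) ⊕ (Fin k × Fin n))

/-- The generic matrix `T` of the Cayley parametrization. -/
def genericT (k n : ℕ) : Matrix (Fin k) (Fin k) (MvPolynomial (CayleyCoord k n) ℂ) :=
  cayleyT (Matrix.of fun i j => X (some (Sum.inl (i, j))))
    (Matrix.of fun i l => X (some (Sum.inr (i, l))))

/-- The generic matrix `W` of the Cayley parametrization. -/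
def genericW (k n : ℕ) : Matrix (Fin k) (Fin n) (MvPolynomial (CayleyCoord k n) ℂ) :=
  cayleyW (Matrix.of fun i l => X (some (Sum.inr (i, l))))

/-- The polynomial `det (z₀ D + U)`, where `D` is a diagonal matrix of signs and `U` is the left
`k × k` block of the matrix. -/
def signedDet (k n : ℕ) (ε : Fin k → ℤˣ) : MvPolynomial (Coord k n) ℂ :=
  ((X none : MvPolynomial (Coord k n) ℂ) • signMatrix (MvPolynomial (Coord k n) ℂ) ε +
    genericMatrix k n * (headMatrix k n (MvPolynomial (Coord k n) ℂ))ᵀ).det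

/-- On the open set where `z₀` and `det (z₀ D + U)` are invertible, the Cayley parametrization
identifies the scheme of the quadrics with an open part of an affine space, which is reduced. -/
theorem map_eq_zero_of_pow_mem_quadricIdeal (hkn : k ≤ n)
    (α : MvPolynomial (Coord k n) ℂ →ₐ[ℂ] S) (hα : ∀ p, α (quadric k n p) = 0)
    (ε : Fin k → ℤˣ) (hz : IsUnit (α (X none)))
    (hdet : IsUnit (α (signedDet k n ε)))
    {f : MvPolynomial (Coord k n) ℂ} {r : ℕ} (hf : f ^ r ∈ quadricIdeal k n) : α f = 0 := by
  set Q := MvPolynomial (CayleyCoord k n) ℂ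
  set L := Localization.Away (genericT k n).det
  set ι : Q →ₐ[ℂ] L := IsScalarTower.toAlgHom ℂ Q L with hι
  set T := (genericT k n).map ι with hT
  set W := (genericW k n).map ι with hW
  have hTdet : IsUnit T.det := by
    have h : T.det = algebraMap Q L (genericT k n).det :=
      (AlgHom.map_det ι (genericT k n)).symm
    rw [h]
    exact IsLocalization.Away.algebraMap_isUnit _
  have hWE : W * (headMatrix k n L)ᵀ = 1 := by
    rw [hW, genericW, cayleyW_map, cayleyW_mul_headMatrix_transpose hkn]
  have hTW : T + Tᵀ = W * Wᵀ := by
    have h1 := cayleyT_map ι (Matrix.of fun i j => X (some (Sum.inl (i, j))))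
      (Matrix.of fun (i : Fin k) (l : Fin n) => X (some (Sum.inr (i, l))))
    have h2 := cayleyW_map ι (Matrix.of fun (i : Fin k) (l : Fin n) => X (some (Sum.inr (i, l))))
    exact (congrArg (fun M => M + Mᵀ) h1).trans ((cayleyT_add_transpose _ _).trans
      (congrArg (fun M => M * Mᵀ) h2).symm)
  -- the parametrization, as a homomorphism to the localized polynomial ring
  let A' : Matrix (Fin k) (Fin n) L :=
    ι (X none) • (signMatrix L ε * (T⁻¹ * W - headMatrix k n L))
  let par : MvPolynomial (Coord k n) ℂ →ₐ[ℂ] L :=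
    aeval fun s => s.elim (ι (X none)) fun p => A' p.1 p.2
  have hparz : par (X none) = ι (X none) := by simp [par]
  have hparA : (genericMatrix k n).map par = A' := by
    ext i l
    simp [par, genericMatrix]
  have hpar : ∀ p, par (quadric k n p) = 0 := by
    rw [forall_map_quadric_eq_zero_iff, hparz, hparA]
    refine mul_transpose_of_cayley hkn _ (Matrix.nonsing_inv_mul _ hTdet) ?_ hWE hTW
    rw [signMatrix_transpose, signMatrix_mul_self]
  have hparf : par f = 0 := by
    have hle : quadricIdeal k n ≤ RingHom.ker par := by
      rw [quadricIdeal, Ideal.span_le]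
      rintro _ ⟨p, rfl⟩
      exact hpar p
    have h0 : par f ^ r = 0 := by
      rw [← map_pow]
      exact hle hf
    exact eq_zero_of_pow_eq_zero h0
  -- the point `α` is in the image of the parametrization
  obtain ⟨z', hz'⟩ := isUnit_iff_exists_inv.1 hz
  set z := α (X none) with hzdef
  set A := (genericMatrix k n).map α with hA
  have hAA : A * Aᵀ = z ^ 2 • (1 : Matrix (Fin k) (Fin k) S) :=
    (forall_map_quadric_eq_zero_iff α).1 hα
  set P := 1 + z' • (signMatrix S ε * A * (headMatrix k n S)ᵀ) with hP
  have hPdet : IsUnit P.det := by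
    have h1 : P = z' • (signMatrix S ε * (z • signMatrix S ε + A * (headMatrix k n S)ᵀ)) := by
      rw [hP, Matrix.mul_add, Matrix.mul_smul, signMatrix_mul_self, smul_add, smul_smul,
        mul_comm z', hz', one_smul, Matrix.mul_assoc]
    have h2 : IsUnit (z • signMatrix S ε + A * (headMatrix k n S)ᵀ).det := by
      convert hdet
      rw [signedDet, AlgHom.map_det]
      congr 1
      have h3 := headMatrix_map (k := k) (n := n) α
      have h4 := signMatrix_map (S' := S) α ε
      rw [← h3, ← h4]
      ext i j
      simp [Matrix.mul_apply, hA, hzdef]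
    have h5 : IsUnit (signMatrix S ε).det := by
      rw [← Matrix.isUnit_iff_isUnit_det]
      exact IsUnit.of_mul_eq_one _ (signMatrix_mul_self ε)
    have h6 : IsUnit z' := IsUnit.of_mul_eq_one z (by rw [mul_comm, hz'])
    rw [h1, Matrix.det_smul, Matrix.det_mul]
    exact (h6.pow _).mul (h5.mul h2)
  obtain ⟨hW1, hTW1, hA1⟩ := cayley_of_mul_transpose hkn hz' (signMatrix_mul_self ε)
    (signMatrix_transpose ε) hAA (Matrix.nonsing_inv_mul P hPdet)
  rw [← hP] at hA1
  set W₁ := P⁻¹ * (z' • (signMatrix S ε * A) + headMatrix k n S)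
  let θ₀ : Q →ₐ[ℂ] S := aeval fun s => s.elim z fun u =>
    u.elim (fun p => ((1 / 2 : ℂ) • P⁻¹) p.1 p.2) fun p => W₁ p.1 p.2
  have hθT : (genericT k n).map θ₀ = P⁻¹ := by
    rw [genericT, cayleyT_map, ← cayleyT_eq_self hkn hW1 hTW1]
    congr 1 <;>
    · ext i j
      simp [θ₀]
  have hθW : (genericW k n).map θ₀ = W₁ := by
    rw [genericW, cayleyW_map, ← cayleyW_eq_self hkn hW1]
    congr 1
    ext i j
    simp [θ₀]
  have hθdet : IsUnit (θ₀ (genericT k n).det) := by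
    have h : θ₀ (genericT k n).det = (P⁻¹).det := by
      rw [← hθT]
      exact AlgHom.map_det θ₀ _
    rw [h]
    exact Matrix.isUnit_nonsing_inv_det P hPdet
  let θ : L →ₐ[ℂ] S := IsLocalization.liftAlgHom (M := Submonoid.powers (genericT k n).det)
    (f := θ₀) (by
      rintro ⟨_, a, rfl⟩
      rw [map_pow]
      exact hθdet.pow a)
  have hθι : ∀ x, θ (ι x) = θ₀ x := fun x => IsLocalization.lift_eq _ x
  have hmapι : ∀ {m : ℕ} (M : Matrix (Fin k) (Fin m) Q), (M.map ι).map θ = M.map θ₀ :=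
    fun M => by
      ext i j
      exact hθι _
  have hθTinv : (T⁻¹).map θ = P := by
    have h1 : (T⁻¹).map θ * P⁻¹ = 1 := by
      rw [← hθT, ← hmapι, ← Matrix.map_mul, Matrix.nonsing_inv_mul _ hTdet]
      exact Matrix.map_one _ (map_zero θ) (map_one θ)
    have h2 : P⁻¹ * P = 1 := Matrix.nonsing_inv_mul P hPdet
    calc (T⁻¹).map θ = (T⁻¹).map θ * (P⁻¹ * P) := by rw [h2, Matrix.mul_one]
      _ = P := by rw [← Matrix.mul_assoc, h1, Matrix.one_mul]
  have hcomp : θ.comp par = α := by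
    have hz1 : θ (ι (X none)) = z := by
      rw [hθι]
      exact aeval_X _ none
    have hA' : A'.map θ = A := by
      rw [← hA1, ← hθTinv, ← hθW, ← hmapι, ← hz1, ← headMatrix_map θ, ← signMatrix_map θ ε]
      ext i l
      simp [A', Matrix.mul_apply, W]
    ext s
    cases s with
    | none => rw [AlgHom.comp_apply, hparz, hz1]
    | some p =>
      rw [AlgHom.comp_apply]
      have h1 : par (X (some p)) = A' p.1 p.2 := by simp [par]
      rw [h1]
      exact congrFun (congrFun hA' p.1) p.2
  rw [← hcomp, AlgHom.comp_apply, hparf, map_zero]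

theorem isRadical_quadricIdeal (hkn : 2 * k ≤ n + 1) : (quadricIdeal k n).IsRadical := by
  have hle : k ≤ n := by
    rcases Nat.eq_zero_or_pos k with h | h <;> omega
  rintro f ⟨r, hf⟩
  -- the polynomials `g` such that a power of `g` multiplies `f` into the ideal
  set J := ((quadricIdeal k n).colon (Ideal.span {f} : Set (MvPolynomial (Coord k n) ℂ))).radical
  have hJ : ∀ g, g ∈ J ↔ ∃ a, g ^ a * f ∈ quadricIdeal k n := fun g => by
    refine exists_congr fun a => ?_
    rw [Submodule.mem_colon]
    constructor
    · exact fun h => h f (Ideal.mem_span_singleton_self f)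
    · intro h x hx
      obtain ⟨y, rfl⟩ := Ideal.mem_span_singleton'.1 hx
      rw [smul_eq_mul, mul_left_comm]
      exact Ideal.mul_mem_left _ _ h
  have hdet : ∀ ε : Fin k → ℤˣ, signedDet k n ε ∈ J := by
    intro ε
    set h := signedDet k n ε
    set B := MvPolynomial (Coord k n) ℂ ⧸ quadricIdeal k n
    set mk := Ideal.Quotient.mkₐ ℂ (quadricIdeal k n)
    set S := Localization.Away (mk (X none * h))
    set α : MvPolynomial (Coord k n) ℂ →ₐ[ℂ] S := (IsScalarTower.toAlgHom ℂ B S).comp mk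
    have hunit : IsUnit (α (X none) * α h) := by
      rw [← map_mul]
      exact IsLocalization.Away.algebraMap_isUnit (mk (X none * h))
    have hαf : α f = 0 := by
      refine map_eq_zero_of_pow_mem_quadricIdeal hle α (fun p => ?_) ε
        (isUnit_of_mul_isUnit_left hunit) (isUnit_of_mul_isUnit_right hunit) hf
      have : mk (quadric k n p) = 0 :=
        Ideal.Quotient.eq_zero_iff_mem.2 (Ideal.subset_span ⟨p, rfl⟩)
      rw [AlgHom.comp_apply, this, map_zero]
    obtain ⟨⟨_, a, rfl⟩, hc⟩ := (IsLocalization.map_eq_zero_iff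
      (Submonoid.powers (mk (X none * h))) S (mk f)).1 hαf
    rw [hJ]
    refine ⟨a, mem_quadricIdeal_of_X_none_pow_mul_mem hkn a ?_⟩
    rw [← mul_assoc, ← mul_pow]
    refine Ideal.Quotient.eq_zero_iff_mem.1 ?_
    rw [map_mul, map_pow]
    exact hc
  have hsum : (2 : MvPolynomial (Coord k n) ℂ) ^ k * X none ^ k ∈ J := by
    rw [← sum_sign_mul_det (genericMatrix k n * (headMatrix k n (MvPolynomial (Coord k n) ℂ))ᵀ)
      (X none)]
    exact sum_mem fun ε _ => Ideal.mul_mem_left _ _ (hdet ε)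
  obtain ⟨a, ha⟩ := (hJ _).1 hsum
  have h2 : (C ((1 / 2 : ℂ) ^ (k * a)) : MvPolynomial (Coord k n) ℂ) * 2 ^ (k * a) = 1 := by
    rw [show (2 : MvPolynomial (Coord k n) ℂ) = C 2 from (map_ofNat C 2).symm, ← map_pow,
      ← map_mul, ← mul_pow]
    norm_num
  refine mem_quadricIdeal_of_X_none_pow_mul_mem hkn (k * a) ?_
  have h3 := Ideal.mul_mem_left _ (C ((1 / 2 : ℂ) ^ (k * a))) ha
  rwa [mul_pow, ← pow_mul, ← pow_mul, mul_assoc, ← mul_assoc, h2, one_mul] at h3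

end Radical

/-! ### The projective closure -/

section Closure

variable {k n : ℕ}

theorem mem_zeroLocus_quadricIdeal_iff (v : Coord k n → ℂ) :
    v ∈ zeroLocus ℂ (quadricIdeal k n) ↔
      matPart v * (matPart v)ᵀ = (v none) ^ 2 • (1 : Matrix (Fin k) (Fin k) ℂ) := by
  have h := forall_map_quadric_eq_zero_iff (aeval v : MvPolynomial (Coord k n) ℂ →ₐ[ℂ] ℂ)
  have hm : (genericMatrix k n).map (aeval v : MvPolynomial (Coord k n) ℂ →ₐ[ℂ] ℂ) =
      matPart v := by
    ext i l
    simp [genericMatrix, matPart]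
  rw [hm, aeval_X] at h
  rw [← h, quadricIdeal, zeroLocus_span]
  exact Set.forall_mem_range

theorem eval_quadric_zero (p : UpperIndex k) :
    eval (0 : Coord k n → ℂ) (quadric k n p) = 0 := by
  simp [quadric, apply_ite]

theorem isHomogeneous_quadric (p : UpperIndex k) : (quadric k n p).IsHomogeneous 2 := by
  refine IsHomogeneous.sub (IsHomogeneous.sum _ _ _ fun l _ => ?_) ?_
  · exact (isHomogeneous_X ℂ _).mul (isHomogeneous_X ℂ _)
  · split_ifs
    · exact isHomogeneous_X_pow _ _
    · exact isHomogeneous_zero _ _ _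

theorem matPart_pairVec (A : Matrix (Fin k) (Fin n) ℂ) (z₀ : ℂ) : matPart (pairVec A z₀) = A :=
  rfl

theorem affineChart_mem_naiveHomogenization {A : Matrix (Fin k) (Fin n) ℂ} (hA : A ∈ stiefel k n) :
    affineChart A ∈ naiveHomogenization k n := by
  rw [affineChart, mk_mem_naiveHomogenization_iff, matPart_pairVec]
  simpa [pairVec, stiefel] using hA

theorem headMatrix_mem_stiefel (hkn : k ≤ n) : headMatrix k n ℂ ∈ stiefel k n :=
  headMatrix_mul_transpose hkn

/-- The affine cone over `Z(k,n)` is the zero locus of the quadrics. Since it contains the origin,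
this uses that `Z(k,n)` is not empty. -/
theorem cone_naiveHomogenization (hkn : k ≤ n) :
    {v : Coord k n → ℂ | ∃ p ∈ naiveHomogenization k n, v ∈ p.submodule} =
      zeroLocus ℂ (quadricIdeal k n) := by
  ext v
  by_cases hv : v = 0
  · subst hv
    refine iff_of_true ⟨_, affineChart_mem_naiveHomogenization (headMatrix_mem_stiefel hkn),
      zero_mem _⟩ ?_
    rw [mem_zeroLocus_quadricIdeal_iff, show matPart (0 : Coord k n → ℂ) = 0 from rfl]
    simp
  · rw [mem_zeroLocus_quadricIdeal_iff, ← mk_mem_naiveHomogenization_iff v hv]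
    constructor
    · rintro ⟨p, hp, hvp⟩
      have : p = Projectivization.mk ℂ v hv := by
        induction p using Projectivization.ind with
        | h w hw =>
          rw [Projectivization.submodule_mk] at hvp
          obtain ⟨a, rfl⟩ := Submodule.mem_span_singleton.1 hvp
          rw [Projectivization.mk_eq_mk_iff']
          have ha : a ≠ 0 := by
            rintro rfl
            simp at hv
          exact ⟨a⁻¹, by rw [smul_smul, inv_mul_cancel₀ ha, one_smul]⟩
      rwa [← this]
    · intro h
      refine ⟨_, h, ?_⟩
      rw [Projectivization.submodule_mk]
      exact Submodule.mem_span_singleton_self v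

theorem projIdeal_naiveHomogenization (hkn : 2 * k ≤ n + 1) :
    projIdeal (naiveHomogenization k n) = quadricIdeal k n := by
  rw [projIdeal, cone_naiveHomogenization (by rcases Nat.eq_zero_or_pos k with h | h <;> omega),
    vanishingIdeal_zeroLocus_eq_radical, (isRadical_quadricIdeal hkn).radical]

/-- A polynomial that vanishes on the lines over the points of `St(k,n)` lies in the ideal of the
quadrics: its product with `z₀` vanishes on the whole zero locus of the quadrics. -/
theorem mem_quadricIdeal_of_vanishesAt (hkn : 2 * k ≤ n + 1) {F : MvPolynomial (Coord k n) ℂ}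
    (hF : ∀ A ∈ stiefel k n, VanishesAt F (affineChart A)) : F ∈ quadricIdeal k n := by
  refine mem_quadricIdeal_of_X_none_mul_mem hkn ?_
  rw [← (isRadical_quadricIdeal hkn).radical, ← vanishingIdeal_zeroLocus_eq_radical (K := ℂ)]
  intro v hv
  rw [map_mul, aeval_X]
  by_cases h0 : v none = 0
  · rw [h0, zero_mul]
  · have hA : (v none)⁻¹ • matPart v ∈ stiefel k n := by
      rw [stiefel, Set.mem_ofPred_eq, Matrix.transpose_smul, Matrix.smul_mul, Matrix.mul_smul,
        (mem_zeroLocus_quadricIdeal_iff v).1 hv, smul_smul, smul_smul]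
      have : (v none)⁻¹ * (v none)⁻¹ * v none ^ 2 = 1 := by field_simp
      rw [this, one_smul]
    have hmem : v ∈ (affineChart ((v none)⁻¹ • matPart v)).submodule := by
      rw [affineChart, Projectivization.submodule_mk, Submodule.mem_span_singleton]
      refine ⟨v none, funext fun s => ?_⟩
      cases s with
      | none => simp [pairVec]
      | some p => simp [pairVec, matPart, h0]
    have h1 := hF _ hA v hmem
    rw [← coe_aeval_eq_eval, RingHom.coe_coe] at h1
    rw [h1, mul_zero]

theorem naiveHomogenization_eq_setOf (k n : ℕ) : naiveHomogenization k n =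
    {p | ∀ F ∈ Set.range (quadric k n), VanishesAt F p} := by
  ext p
  induction p using Projectivization.ind with
  | h v hv =>
    rw [mk_mem_naiveHomogenization_iff, ← mem_zeroLocus_quadricIdeal_iff, quadricIdeal,
      zeroLocus_span]
    simp only [Set.mem_ofPred_eq, Set.forall_mem_range]
    refine forall_congr' fun p => ?_
    rw [vanishesAt_mk_iff (isHomogeneous_quadric p), ← coe_aeval_eq_eval, RingHom.coe_coe]

theorem isZariskiClosed_naiveHomogenization (k n : ℕ) :
    IsZariskiClosed (naiveHomogenization k n) := by
  refine ⟨_, ?_, naiveHomogenization_eq_setOf k n⟩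
  rintro _ ⟨p, rfl⟩
  exact ⟨2, isHomogeneous_quadric p⟩

theorem stiefelClosure_eq_naiveHomogenization (hkn : 2 * k ≤ n + 1) :
    stiefelClosure k n = naiveHomogenization k n := by
  apply Set.Subset.antisymm
  · refine Set.sInter_subset_of_mem ⟨isZariskiClosed_naiveHomogenization k n, ?_⟩
    rintro _ ⟨A, hA, rfl⟩
    exact affineChart_mem_naiveHomogenization hA
  · rintro p hp _ ⟨⟨S, -, rfl⟩, hsub⟩ F hF
    have hFI : F ∈ quadricIdeal k n :=
      mem_quadricIdeal_of_vanishesAt hkn fun A hA => hsub ⟨A, hA, rfl⟩ F hF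
    rw [← projIdeal_naiveHomogenization hkn] at hFI
    intro v hv
    have := hFI v ⟨p, hp, hv⟩
    rwa [← coe_aeval_eq_eval, RingHom.coe_coe]

end Closure

/-! ### Homogenization -/

section Homogenization

variable {k n : ℕ}

/-- Setting `z₀ = 1`. -/
def dehomogenize (k n : ℕ) : MvPolynomial (Coord k n) ℂ →ₐ[ℂ] MvPolynomial (Fin k × Fin n) ℂ :=
  aeval fun s => s.elim 1 X

theorem aeval_entries_dehomogenize (A : Matrix (Fin k) (Fin n) ℂ)
    (F : MvPolynomial (Coord k n) ℂ) :
    aeval (entries A) (dehomogenize k n F) = eval (pairVec A 1) F := by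
  rw [← coe_aeval_eq_eval, RingHom.coe_coe, ← AlgHom.comp_apply]
  congr 1
  ext s
  cases s <;> simp [dehomogenize, entries, pairVec]

theorem dehomogenize_monomial (γ : Coord k n →₀ ℕ) :
    dehomogenize k n (monomial γ 1) = monomial γ.some 1 := by
  rw [dehomogenize, aeval_monomial, map_one, one_mul, Finsupp.prod_option_index _ _ (by simp)
    (by simp [pow_add]), monomial_eq]
  simp

theorem map_dehomogenize_homogeneousSubmodule (t : ℕ) :
    (homogeneousSubmodule (Coord k n) ℂ t).map (dehomogenize k n).toLinearMap =
      restrictTotalDegree (Fin k × Fin n) ℂ t := by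
  rw [homogeneousSubmodule_eq_restrictSupport, restrictTotalDegree]
  apply le_antisymm
  · rw [restrictSupport_eq_span, Submodule.map_span, Submodule.span_le]
    rintro _ ⟨_, ⟨γ, hγ, rfl⟩, rfl⟩
    rw [AlgHom.toLinearMap_apply, dehomogenize_monomial, SetLike.mem_coe,
      monomial_mem_restrictSupport]
    left
    have hdeg : γ.degree = t := hγ
    have h : γ.sum (fun _ e => e) = γ none + γ.some.sum (fun _ e => e) :=
      Finsupp.sum_option_index γ (fun _ e => e) (fun _ => rfl) (fun _ _ _ => rfl)
    have h' : γ.sum (fun _ e => e) = γ.degree := rfl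
    simp only [Set.mem_ofPred_eq]
    omega
  · rw [restrictSupport_eq_span, Submodule.span_le]
    rintro _ ⟨γ, hγ, rfl⟩
    have hdeg : γ.degree ≤ t := hγ
    refine ⟨X none ^ (t - γ.degree) * rename some (monomial γ 1), ?_, ?_⟩
    · rw [← homogeneousSubmodule_eq_restrictSupport, SetLike.mem_coe, mem_homogeneousSubmodule]
      have h := (isHomogeneous_X_pow (R := ℂ) (none : Coord k n) (t - γ.degree)).mul
        (IsHomogeneous.rename_isHomogeneous (f := (some : _ → Coord k n))
          (isHomogeneous_monomial (1 : ℂ) (rfl : γ.degree = γ.degree)))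
      rwa [Nat.sub_add_cancel hdeg] at h
    · have h : (dehomogenize k n).comp (rename some) = AlgHom.id ℂ _ := by
        ext p
        simp [dehomogenize]
      have h1 := DFunLike.congr_fun h (monomial γ 1)
      rw [AlgHom.comp_apply, AlgHom.id_apply] at h1
      rw [AlgHom.toLinearMap_apply, map_mul, h1, map_pow]
      simp [dehomogenize]

theorem projHilbertFunction_eq_finrank {σ : Type} {X : Set (ℙ ℂ (σ → ℂ))}
    {J : Ideal (MvPolynomial σ ℂ)} (h : projIdeal X = J) (t : ℕ) :
    projHilbertFunction X t = Module.finrank ℂ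
      ((homogeneousSubmodule σ ℂ t).map (Ideal.Quotient.mkₐ ℂ J).toLinearMap) := by
  subst h
  rfl

/-- A homogeneous polynomial lies in the ideal of the quadrics if and only if its dehomogenization
vanishes on `St(k,n)`. -/
theorem dehomogenize_mem_vanishingIdeal_iff (hkn : 2 * k ≤ n + 1) {t : ℕ}
    {F : MvPolynomial (Coord k n) ℂ} (hF : F.IsHomogeneous t) :
    dehomogenize k n F ∈ vanishingIdeal ℂ (stiefelAffine k n) ↔ F ∈ quadricIdeal k n := by
  constructor
  · intro h
    refine mem_quadricIdeal_of_vanishesAt hkn fun A hA => ?_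
    rw [affineChart, vanishesAt_mk_iff hF, ← aeval_entries_dehomogenize]
    exact h _ ⟨A, hA, rfl⟩
  · rintro h _ ⟨A, hA, rfl⟩
    have hv : pairVec A 1 ∈ zeroLocus ℂ (quadricIdeal k n) := by
      rw [mem_zeroLocus_quadricIdeal_iff, matPart_pairVec]
      simpa [pairVec, stiefel] using hA
    rw [aeval_entries_dehomogenize, ← coe_aeval_eq_eval, RingHom.coe_coe]
    exact hv F h

theorem finrank_map_eq_of_ker_eq {K V V₁ V₂ : Type*} [Field K] [AddCommGroup V] [Module K V]
    [AddCommGroup V₁] [Module K V₁] [AddCommGroup V₂] [Module K V₂] (f₁ : V →ₗ[K] V₁)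
    (f₂ : V →ₗ[K] V₂) (U : Submodule K V) (h : ∀ x ∈ U, f₁ x = 0 ↔ f₂ x = 0) :
    Module.finrank K (U.map f₁) = Module.finrank K (U.map f₂) := by
  have hker : LinearMap.ker (f₁.domRestrict U) = LinearMap.ker (f₂.domRestrict U) := by
    ext ⟨x, hx⟩
    exact h x hx
  rw [← LinearMap.range_domRestrict, ← LinearMap.range_domRestrict,
    ← (f₁.domRestrict U).quotKerEquivRange.finrank_eq,
    ← (f₂.domRestrict U).quotKerEquivRange.finrank_eq, hker]

theorem affineHilbertFunction_stiefelAffine (hkn : 2 * k ≤ n + 1) (t : ℕ) :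
    affineHilbertFunction (stiefelAffine k n) t =
      projHilbertFunction (naiveHomogenization k n) t := by
  rw [affineHilbertFunction,
    projHilbertFunction_eq_finrank (projIdeal_naiveHomogenization hkn),
    ← map_dehomogenize_homogeneousSubmodule, ← Submodule.map_comp]
  refine finrank_map_eq_of_ker_eq _ _ _ fun F hF => ?_
  have h := dehomogenize_mem_vanishingIdeal_iff hkn ((mem_homogeneousSubmodule t F).1 hF)
  rw [← Ideal.Quotient.eq_zero_iff_mem, ← Ideal.Quotient.eq_zero_iff_mem] at h
  exact h

end Homogenization

/-! ### Codimension and degree -/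

theorem card_upperIndex (k : ℕ) : Fintype.card (UpperIndex k) = (k + 1).choose 2 := by
  rw [← Fintype.card_congr (Sym2.sortEquiv (α := Fin k)), Sym2.card, Fintype.card_fin]

theorem projHilbertFunction_naiveHomogenization {k n : ℕ} (hkn : 2 * k ≤ n + 1) :
    projHilbertFunction (naiveHomogenization k n) =
      fun t => (standardExponents (leadingExponent hkn) Set.univ t).ncard := by
  ext t
  rw [projHilbertFunction_eq_finrank (projIdeal_naiveHomogenization hkn)]
  exact finrank_map_mk_homogeneousSubmodule (isCoprimeFamily_leadingExponent hkn)
    (hasLeadingMonomial_quadric hkn) t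

theorem card_upperIndex_lt {k n : ℕ} (hkn : 2 * k ≤ n + 1) :
    Fintype.card (UpperIndex k) < Fintype.card (Coord k n) := by
  -- the leading monomials contain distinct matrix entries
  have hle : Fintype.card (UpperIndex k) ≤ Fintype.card (Fin k × Fin n) := by
    refine Fintype.card_le_of_injective (fun p => (p.1.1, leadingColumn hkn p)) fun p q h => ?_
    simp only [leadingColumn, Prod.mk.injEq, Fin.ext_iff] at h
    exact Subtype.ext (Prod.ext (Fin.ext h.1) (Fin.ext (by omega)))
  rw [Fintype.card_option]
  omega

theorem projHasCodim_naiveHomogenization {k n : ℕ} (hkn : 2 * k ≤ n + 1) :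
    ProjHasCodim (naiveHomogenization k n) (Fintype.card (UpperIndex k)) := by
  rw [ProjHasCodim, projIdeal_naiveHomogenization hkn]
  exact le_antisymm (ringKrullDim_quotient_add_card_le (isCoprimeFamily_leadingExponent hkn)
    (hasLeadingMonomial_quadric hkn)) (card_le_ringKrullDim_quotient_add_card eval_quadric_zero)

end StiefelDegree

end

theorem theorem3p3 (k n : ℕ) (hkn : 2 * k ≤ n + 1) :
    StiefelDegree.stiefelClosure k n = StiefelDegree.naiveHomogenization k n ∧
    StiefelDegree.IsCompleteIntersection (StiefelDegree.stiefelClosure k n)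
      (StiefelDegree.quadric k n) (fun _ => 2) ∧
    Fintype.card (StiefelDegree.UpperIndex k) = (k + 1).choose 2 ∧
    StiefelDegree.ProjHasDegree (StiefelDegree.stiefelClosure k n) (2 ^ (k + 1).choose 2) ∧
    StiefelDegree.AffineHasDegree (StiefelDegree.stiefelAffine k n) (2 ^ (k + 1).choose 2) := by
  have hclosure := StiefelDegree.stiefelClosure_eq_naiveHomogenization hkn
  have hdeg : StiefelDegree.ProjHasDegree (StiefelDegree.naiveHomogenization k n)
      (2 ^ (k + 1).choose 2) := by
    rw [StiefelDegree.ProjHasDegree, StiefelDegree.projHilbertFunction_naiveHomogenization hkn,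
      ← StiefelDegree.card_upperIndex]
    exact StiefelDegree.hilbertFunctionHasDegree_standardExponents
      (StiefelDegree.isCoprimeFamily_leadingExponent hkn)
      (StiefelDegree.degree_leadingExponent hkn) (StiefelDegree.card_upperIndex_lt hkn)
  refine ⟨hclosure, ?_, StiefelDegree.card_upperIndex k, ?_, ?_⟩
  · rw [hclosure]
    exact ⟨StiefelDegree.isZariskiClosed_naiveHomogenization k n,
      StiefelDegree.isHomogeneous_quadric, StiefelDegree.projIdeal_naiveHomogenization hkn,
      StiefelDegree.projHasCodim_naiveHomogenization hkn⟩
  · rwa [hclosure]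
  · rw [StiefelDegree.AffineHasDegree,
      funext (StiefelDegree.affineHilbertFunction_stiefelAffine hkn)]
    exact hdeg
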